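/- Let $L>0$, let $J\subseteq\mathbb R$ be an open interval, and let $q(x,t)$, $x\in\mathbb R$, $t\in J$, be a classical solution of the defocusing NLS equation $\mathrm i q_t+q_{xx}-2|q|^2q=0$ with $q(x+L,t)=q(x,t)$ (that is, $q$ is $C^2$ in $x$ and differentiable in $t$, and $q,q_x,q_{xx}$ are continuous in $(x,t)$). Let $\mathcal L=\mathrm i\sigma_3(\partial_x-Q)$ with $\sigma_3=\begin{pmatrix}1&0\\0&-1\end{pmatrix}$ and $Q=\begin{pmatrix}0&q\\q^*&0\end{pmatrix}$. Let $Y(x,t,z)$ be the matrix solution of $Y_x=(-\mathrm i z\sigma_3+Q)Y$ with $Y(0,t,z)=I$, let $\Delta(t,z)=\tfrac12\operatorname{tr}Y(L,t,z)$, and let $\tilde Y=(\tilde y_{ij})=UYU^{-1}$ with $U=\begin{pmatrix}1&1\\-\mathrm i&\mathrm i\end{pmatrix}$. Let $\rho(z)$ be the root of $\rho^2-2\Delta(t,z)\rho+1=0$ with $|\rho(z)|<1$ when $\Delta(t,z)\notin[-1,1]$, extended to the (real) points $z$ with $\Delta(t,z)\in[-1,1]$ by its limit from the upper half plane. Number the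 real solutions of $\Delta(t,\zeta)^2=1$ as $\dots<\zeta_{2n-1}(t)\le\zeta_{2n}(t)<\zeta_{2n+1}(t)\le\dots$, $n\in\mathbb Z$, so that $|\Delta|>1$ on $(\zeta_{2n-1},\zeta_{2n})$ and $|\Delta|<1$ on $(\zeta_{2n},\zeta_{2n+1})$, with the origin of the numbering fixed by $\zeta_{-2}<0\le\zeta_0$. A Dirichlet eigenvalue at time $t$ is a $\mu\in\mathbb C$ for which there is a nonzero $v\in H^1([0,L],\mathbb C^2)$ with $\mathcal Lv=\mu v$ and $v_1+v_2=0$ at $x=0$ and at $x=L$; let $\mu_n(t)$ be the Dirichlet eigenvalue in $[\zeta_{2n-1}(t),\zeta_{2n}(t)]$. Put $\sigma_n(t)=-\operatorname{sgn}\log|\tilde y_{22}(L,t,\mu_n(t))|$ (with $\operatorname{sgn}0=0$). Then, for all $n\in\mathbb Z$ and $t\in J$, with $\tilde y_{12}'=\partial\tilde y_{12}/\partial z$, we have $\tilde y_{12}'(L,t,\mu_n(t))\ne0$, the function $\mu_n$ is differentiable at $t$, and $$\frac{d\mu_n(t)}{dt}=\sigma_n(t)\,c_1(\mu_n(t))\,\frac{\rho(\mu_n(t))-\rho^{-1}(\mu_n(t))}{\tilde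 y_{12}'(L,t,\mu_n(t))},$$ where $$c_1(z)=-2z^2-\mathrm i z\,(q^*(0,t)-q(0,t))-|q(0,t)|^2-\tfrac12\,(q_x(0,t)+q_x^*(0,t)).$$ In particular, if $\sigma_n(t)=0$ for all $t\in J$, then $\mu_n$ is constant on $J$. Moreover, if $\mu_n$ is a fixed Dirichlet eigenvalue, that is, if $\zeta_{2n-1}(s)=\zeta_{2n}(s)$ for some $s\in J$, then $\sigma_n(t)=0$ and $\mu_n(t)=\mu_n(s)$ for all $t\in J$. -/

import Mathlib

open Filter Topology MeasureTheory
open scoped ComplexConjugate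

namespace NLSDirichlet

noncomputable section

/-! ### The Zakharov-Shabat (Dirac) eigenvalue problem `ℒ v = z v`, `ℒ = i σ₃ (∂ₓ - Q)` -/

/-- The third Pauli matrix. -/
def sigma3 : Matrix (Fin 2) (Fin 2) ℂ := !![1, 0; 0, -1]

/-- The matrix potential `Q(x)` of a scalar potential `u`. -/
def potentialMatrix (u : ℝ → ℂ) (x : ℝ) : Matrix (Fin 2) (Fin 2) ℂ :=
  !![0, u x; conj (u x), 0]

/-- The coefficient matrix `-i z σ₃ + Q(x)` of the first-order system equivalent to
`ℒ v = z v`. -/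
def zsMatrix (u : ℝ → ℂ) (z : ℂ) (x : ℝ) : Matrix (Fin 2) (Fin 2) ℂ :=
  (-(Complex.I * z)) • sigma3 + potentialMatrix u x

/-- `Y` is the matrix solution of `Y_x = (-i z σ₃ + Q) Y` on `ℝ` with `Y(0) = 1`
(the derivative is taken entry by entry). -/
def IsPrincipalSolution (u : ℝ → ℂ) (z : ℂ) (Y : ℝ → Matrix (Fin 2) (Fin 2) ℂ) : Prop :=
  Y 0 = 1 ∧ ∀ (x : ℝ) (i j : Fin 2),
    HasDerivAt (fun s => Y s i j) ((zsMatrix u z x * Y x) i j) x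

/-! Existence and uniqueness of the principal solution. -/

section Existence

variable {R : Type*} [NormedRing R] [NormedAlgebra ℝ R]

/-- The terms of the Picard series of `Y' = A Y`, `Y(0) = 1`. -/
def picardTerm (A : ℝ → R) : ℕ → ℝ → R
  | 0 => fun _ => 1
  | n + 1 => fun x => ∫ s in (0 : ℝ)..x, A s * picardTerm A n s

theorem picardTerm_continuous {A : ℝ → R} (hA : Continuous A) (n : ℕ) :
    Continuous (picardTerm A n) := by
  induction n with
  | zero => exact continuous_const
  | succ n ih =>
    exact intervalIntegral.continuous_primitive
      (fun a b => (hA.mul ih).intervalIntegrable a b) 0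

theorem picardTerm_hasDerivAt [CompleteSpace R] {A : ℝ → R} (hA : Continuous A) (n : ℕ) (x : ℝ) :
    HasDerivAt (picardTerm A (n + 1)) (A x * picardTerm A n x) x := by
  have hc : Continuous fun s => A s * picardTerm A n s := hA.mul (picardTerm_continuous hA n)
  exact intervalIntegral.integral_hasDerivAt_right (hc.intervalIntegrable 0 x)
    (hc.stronglyMeasurableAtFilter _ _) hc.continuousAt

theorem picardTerm_norm_le {A : ℝ → R} {K r : ℝ} (hK : 0 ≤ K)
    (hAK : ∀ x, |x| ≤ r → ‖A x‖ ≤ K) (n : ℕ) :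
    ∀ x, |x| ≤ r → ‖picardTerm A n x‖ ≤ ‖(1 : R)‖ * ((K * |x|) ^ n / n.factorial) := by
  induction n with
  | zero => intro x _; simp [picardTerm]
  | succ n ih =>
    have hb : ∀ s, |s| ≤ r → ‖A s * picardTerm A n s‖
        ≤ ‖(1 : R)‖ * K ^ (n + 1) / n.factorial * |s| ^ n := by
      intro s hs
      calc ‖A s * picardTerm A n s‖ ≤ ‖A s‖ * ‖picardTerm A n s‖ := norm_mul_le _ _
        _ ≤ K * (‖(1 : R)‖ * ((K * |s|) ^ n / n.factorial)) := by
            gcongr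
            · exact hAK s hs
            · exact ih s hs
        _ = _ := by rw [mul_pow]; ring
    have hfac : ((n + 1).factorial : ℝ) = (n + 1) * n.factorial := by
      rw [Nat.factorial_succ]; push_cast; ring
    have hn : (n.factorial : ℝ) ≠ 0 := by exact_mod_cast n.factorial_ne_zero
    have hn1 : (n : ℝ) + 1 ≠ 0 := by positivity
    intro x hx
    rcases le_total 0 x with h0 | h0
    · have h1 : ‖∫ s in (0 : ℝ)..x, A s * picardTerm A n s‖
          ≤ ∫ s in (0 : ℝ)..x, ‖(1 : R)‖ * K ^ (n + 1) / n.factorial * s ^ n := by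
        refine intervalIntegral.norm_integral_le_of_norm_le h0 ?_
          ((by fun_prop : Continuous fun s : ℝ =>
            ‖(1 : R)‖ * K ^ (n + 1) / n.factorial * s ^ n).intervalIntegrable _ _)
        refine Filter.Eventually.of_forall fun s hs => ?_
        have h2 : |s| = s := abs_of_pos hs.1
        have h3 := hb s (by rw [h2]; rw [abs_of_nonneg h0] at hx; exact hs.2.trans hx)
        rwa [h2] at h3
      rw [intervalIntegral.integral_const_mul, integral_pow] at h1
      refine h1.trans (le_of_eq ?_)
      rw [abs_of_nonneg h0, hfac, mul_pow]
      field_simp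
      simp
    · have h1 : ‖∫ s in x..(0 : ℝ), A s * picardTerm A n s‖
          ≤ ∫ s in x..(0 : ℝ), ‖(1 : R)‖ * K ^ (n + 1) / n.factorial * (-s) ^ n := by
        refine intervalIntegral.norm_integral_le_of_norm_le h0 ?_
          ((by fun_prop : Continuous fun s : ℝ =>
            ‖(1 : R)‖ * K ^ (n + 1) / n.factorial * (-s) ^ n).intervalIntegrable _ _)
        refine Filter.Eventually.of_forall fun s hs => ?_
        have h2 : |s| = -s := abs_of_nonpos hs.2
        have h3 := hb s (by
          rw [h2]; rw [abs_of_nonpos h0] at hx; linarith [hs.1])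
        rwa [h2] at h3
      rw [intervalIntegral.integral_const_mul,
        intervalIntegral.integral_comp_neg (fun s : ℝ => s ^ n), integral_pow] at h1
      have h4 : picardTerm A (n + 1) x = -∫ s in x..(0 : ℝ), A s * picardTerm A n s :=
        intervalIntegral.integral_symm _ _
      rw [h4, norm_neg]
      refine h1.trans (le_of_eq ?_)
      rw [abs_of_nonpos h0, hfac, mul_pow]
      field_simp
      simp

/-- A linear equation `Y' = A Y` with continuous coefficient has a global solution with
`Y(0) = 1`. -/
theorem exists_linear_solution [CompleteSpace R] {A : ℝ → R} (hA : Continuous A) :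
    ∃ Y : ℝ → R, Y 0 = 1 ∧ ∀ x, HasDerivAt Y (A x * Y x) x := by
  have key : ∀ r : ℝ, 0 < r → ∀ x, |x| < r →
      Summable (fun n => picardTerm A n x) ∧
      HasDerivAt (fun y => ∑' n, picardTerm A n y) (A x * ∑' n, picardTerm A n x) x := by
    intro r hr x hx
    obtain ⟨K', hK'⟩ := (isCompact_Icc (a := -r) (b := r)).exists_bound_of_continuousOn
      hA.continuousOn
    set K := max K' 0 with hKdef
    have hK : 0 ≤ K := le_max_right _ _
    have hAK : ∀ x, |x| ≤ r → ‖A x‖ ≤ K := fun x hx =>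
      (hK' x (abs_le.1 hx)).trans (le_max_left _ _)
    have hle := fun n => picardTerm_norm_le hK hAK n
    have hle' : ∀ n x, |x| ≤ r →
        ‖picardTerm A n x‖ ≤ ‖(1 : R)‖ * ((K * r) ^ n / n.factorial) := by
      intro n x hx
      refine (hle n x hx).trans ?_
      gcongr
    have hs0 : Summable fun n : ℕ => ‖(1 : R)‖ * ((K * r) ^ n / n.factorial) :=
      (Real.summable_pow_div_factorial _).mul_left _
    have hsum : ∀ x, |x| ≤ r → Summable (fun n => picardTerm A n x) := fun x hx =>
      Summable.of_norm_bounded hs0 (fun n => hle' n x hx)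
    refine ⟨hsum x hx.le, ?_⟩
    have hd := hasDerivAt_tsum_of_isPreconnected
      (𝕜 := ℝ) (g := fun n => picardTerm A (n + 1))
      (g' := fun n y => A y * picardTerm A n y)
      (u := fun n : ℕ => K * (‖(1 : R)‖ * ((K * r) ^ n / n.factorial)))
      (t := Metric.ball (0 : ℝ) r) (y₀ := 0) (y := x)
      (hs0.mul_left _) Metric.isOpen_ball (convex_ball _ _).isPreconnected
      (fun n y _ => picardTerm_hasDerivAt hA n y)
      (fun n y hy => by
        have hy' : |y| ≤ r := by
          have := Metric.mem_ball.1 hy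
          rw [Real.dist_eq, sub_zero] at this
          exact this.le
        refine (norm_mul_le _ _).trans ?_
        gcongr
        · exact hAK y hy'
        · exact hle' n y hy')
      (Metric.mem_ball_self hr)
      ((summable_nat_add_iff 1).2 (hsum 0 (by simpa using hr.le)))
      (by rw [Metric.mem_ball, Real.dist_eq, sub_zero]; exact hx)
    rw [(hsum x hx.le).tsum_mul_left (A x)] at hd
    have heq : (fun y => ∑' n, picardTerm A n y)
        =ᶠ[𝓝 x] fun y => 1 + ∑' n, picardTerm A (n + 1) y := by
      filter_upwards [(isOpen_lt continuous_abs continuous_const).mem_nhds hx] with y hy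
      rw [(hsum y (le_of_lt hy)).tsum_eq_zero_add]
      rfl
    exact (hd.const_add 1).congr_of_eventuallyEq heq
  refine ⟨fun y => ∑' n, picardTerm A n y, ?_, fun x => ?_⟩
  · have : ∀ n, n ≠ 0 → picardTerm A n 0 = 0 := by
      intro n hn
      obtain ⟨m, rfl⟩ := Nat.exists_eq_succ_of_ne_zero hn
      exact intervalIntegral.integral_same
    change ∑' n, picardTerm A n 0 = 1
    rw [tsum_eq_single 0 this]
    rfl
  · exact (key (|x| + 1) (by positivity) x (by linarith)).2

theorem linear_solution_unique {A : ℝ → R} (hA : Continuous A) {Y Z : ℝ → R}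
    (hY : ∀ x, HasDerivAt Y (A x * Y x) x) (hZ : ∀ x, HasDerivAt Z (A x * Z x) x)
    (h0 : Y 0 = Z 0) : Y = Z := by
  funext x
  set r := |x| + 1 with hr
  obtain ⟨K', hK'⟩ := (isCompact_Icc (a := -r) (b := r)).exists_bound_of_continuousOn
    hA.continuousOn
  have hr0 : 0 < r := by positivity
  have hx : |x| < r := by rw [hr]; linarith
  have := ODE_solution_unique_of_mem_Ioo (v := fun s y => A s * y) (s := fun _ => Set.univ)
    (K := Real.toNNReal K') (a := -r) (b := r) (t₀ := 0) (f := Y) (g := Z)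
    (fun t ht => by
      refine LipschitzOnWith.of_dist_le_mul fun y _ z _ => ?_
      rw [dist_eq_norm, dist_eq_norm, ← mul_sub]
      refine (norm_mul_le _ _).trans ?_
      gcongr
      exact (hK' t ⟨ht.1.le, ht.2.le⟩).trans (Real.le_coe_toNNReal _))
    ⟨by linarith, hr0⟩
    (fun t _ => ⟨hY t, trivial⟩) (fun t _ => ⟨hZ t, trivial⟩) h0
  exact this (abs_lt.1 hx)

end Existence

section

attribute [local instance] Matrix.linftyOpNormedRing Matrix.linftyOpNormedAlgebra

theorem zsMatrix_continuous {u : ℝ → ℂ} (hu : Continuous u) (z : ℂ) :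
    Continuous (zsMatrix u z) := by
  refine continuous_matrix fun i j => ?_
  fin_cases i <;> fin_cases j <;> simp [zsMatrix, sigma3, potentialMatrix] <;> fun_prop

theorem isPrincipalSolution_iff {u : ℝ → ℂ} {z : ℂ} {Y : ℝ → Matrix (Fin 2) (Fin 2) ℂ} :
    IsPrincipalSolution u z Y ↔ Y 0 = 1 ∧ ∀ x, HasDerivAt Y (zsMatrix u z x * Y x) x := by
  refine and_congr_right fun _ => forall_congr' fun x => ?_
  constructor
  · intro h
    have h2 : HasDerivAt
        (fun s => ∑ i : Fin 2, ∑ j : Fin 2, Y s i j • Matrix.single i j (1 : ℂ))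
        (∑ i : Fin 2, ∑ j : Fin 2,
          (zsMatrix u z x * Y x) i j • Matrix.single i j (1 : ℂ)) x :=
      HasDerivAt.fun_sum fun i _ => HasDerivAt.fun_sum fun j _ => (h i j).smul_const _
    have h3 : ∀ M : Matrix (Fin 2) (Fin 2) ℂ,
        ∑ i : Fin 2, ∑ j : Fin 2, M i j • Matrix.single i j (1 : ℂ) = M := by
      intro M
      conv_rhs => rw [Matrix.matrix_eq_sum_single M]
      simp [Matrix.smul_single]
    simpa only [h3] using h2
  · intro h i j
    let l : Matrix (Fin 2) (Fin 2) ℂ →L[ℝ] ℂ :=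
      LinearMap.toContinuousLinearMap (Matrix.entryLinearMap ℝ ℂ i j)
    exact l.hasFDerivAt.comp_hasDerivAt x h

/-- For a continuous potential the principal solution exists and is unique. -/
theorem existsUnique_principalSolution {u : ℝ → ℂ} (hu : Continuous u) (z : ℂ) :
    ∃! Y, IsPrincipalSolution u z Y := by
  obtain ⟨Y, hY0, hY⟩ := exists_linear_solution (zsMatrix_continuous hu z)
  refine ⟨Y, isPrincipalSolution_iff.2 ⟨hY0, hY⟩, fun Z hZ => ?_⟩
  obtain ⟨hZ0, hZ⟩ := isPrincipalSolution_iff.1 hZ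
  exact linear_solution_unique (zsMatrix_continuous hu z) hZ hY (hZ0.trans hY0.symm)

end

/-- The principal matrix solution `Y(x, z)`. -/
def principalSolution (u : ℝ → ℂ) (z : ℂ) : ℝ → Matrix (Fin 2) (Fin 2) ℂ :=
  Classical.epsilon (IsPrincipalSolution u z)

theorem isPrincipalSolution_principalSolution {u : ℝ → ℂ} (hu : Continuous u) (z : ℂ) :
    IsPrincipalSolution u z (principalSolution u z) :=
  Classical.epsilon_spec (existsUnique_principalSolution hu z).exists

/-! ### Floquet theory -/

/-- The monodromy matrix `M(z) = Y(L, z)`. -/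
def monodromy (u : ℝ → ℂ) (L : ℝ) (z : ℂ) : Matrix (Fin 2) (Fin 2) ℂ :=
  principalSolution u z L

/-- The Floquet discriminant `Δ(z) = ½ tr M(z)`. -/
def discriminant (u : ℝ → ℂ) (L : ℝ) (z : ℂ) : ℂ :=
  1 / 2 * (monodromy u L z).trace

/-- `r` is a Floquet multiplier at `z`: a root of `ρ² - 2 Δ(z) ρ + 1 = 0`. -/
def IsFloquetMultiplier (u : ℝ → ℂ) (L : ℝ) (z r : ℂ) : Prop :=
  r ^ 2 - 2 * discriminant u L z * r + 1 = 0

theorem floquetMultiplier_unique {u : ℝ → ℂ} {L : ℝ} {z r s : ℂ}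
    (hr : IsFloquetMultiplier u L z r) (hs : IsFloquetMultiplier u L z s)
    (hr1 : ‖r‖ < 1) (hs1 : ‖s‖ < 1) : r = s := by
  by_contra hne
  have h : (r - s) * (r * s - 1) = 0 := by
    unfold IsFloquetMultiplier at hr hs
    linear_combination s * hr - r * hs
  have h1 : r * s = 1 := by
    rcases mul_eq_zero.1 h with h | h
    · exact absurd (sub_eq_zero.1 h) hne
    · exact sub_eq_zero.1 h
  have h2 : ‖r‖ * ‖s‖ = 1 := by rw [← norm_mul, h1, norm_one]
  nlinarith [norm_nonneg r, norm_nonneg s]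

open Classical in
/-- The Floquet multiplier of modulus less than one, at the points `z` where there is one, that
is, where `Δ(z) ∉ [-1, 1]` (elsewhere the value is irrelevant). -/
def innerMultiplier (u : ℝ → ℂ) (L : ℝ) (z : ℂ) : ℂ :=
  if h : ∃ r, IsFloquetMultiplier u L z r ∧ ‖r‖ < 1 then h.choose else 1

open Classical in
/-- The Floquet multiplier `ρ(z)`: it has modulus less than one off the Lax spectrum
`{z | Δ(z) ∈ [-1, 1]}`, and on the Lax spectrum, which is real, it is the limit from above. -/
def rho (u : ℝ → ℂ) (L : ℝ) (z : ℂ) : ℂ :=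
  if ∃ r, IsFloquetMultiplier u L z r ∧ ‖r‖ < 1 then innerMultiplier u L z
  else limUnder (𝓝[>] (0 : ℝ)) fun ε => innerMultiplier u L (z + ε * Complex.I)

/-- The main spectrum `{ζ | Δ(ζ)² = 1}`. -/
def mainSpectrum (u : ℝ → ℂ) (L : ℝ) : Set ℂ :=
  {z | discriminant u L z ^ 2 = 1}

/-- The numbering `⋯ < ζ₋₁ ≤ ζ₀ < ζ₁ ≤ ζ₂ < ⋯` of the main spectrum (which is real) for which
the intervals `(ζ₂ⱼ, ζ₂ⱼ₊₁)` are the stable bands `|Δ| < 1` and the intervals `(ζ₂ⱼ₋₁, ζ₂ⱼ)` the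
gaps `|Δ| > 1`, a gap being degenerate when `ζ₂ⱼ₋₁ = ζ₂ⱼ`. The origin of the numbering is fixed
by letting `[ζ₋₁, ζ₀]` be the first closed gap that is not contained in `(-∞, 0)`. -/
structure IsMainNumbering (u : ℝ → ℂ) (L : ℝ) (ζ : ℤ → ℝ) : Prop where
  range : ∀ x : ℝ, (∃ k, ζ k = x) ↔ (x : ℂ) ∈ mainSpectrum u L
  gap_le : ∀ j : ℤ, ζ (2 * j - 1) ≤ ζ (2 * j)
  band_lt : ∀ j : ℤ, ζ (2 * j) < ζ (2 * j + 1)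
  gap : ∀ j : ℤ, ∀ x ∈ Set.Ioo (ζ (2 * j - 1)) (ζ (2 * j)), 1 < ‖discriminant u L x‖
  band : ∀ j : ℤ, ∀ x ∈ Set.Ioo (ζ (2 * j)) (ζ (2 * j + 1)), ‖discriminant u L x‖ < 1
  origin : ζ (-2) < 0 ∧ 0 ≤ ζ 0

/-! ### The Dirichlet spectrum -/

/-- `v` belongs to `H¹([0, L], ℂ²)` and `g` is its weak derivative. -/
def HasWeakDerivH1 (L : ℝ) (v g : ℝ → Fin 2 → ℂ) : Prop :=
  (∀ j, MemLp (fun x => g x j) 2 (volume.restrict (Set.Icc 0 L))) ∧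
    ∀ x ∈ Set.Icc 0 L, ∀ j, v x j = v 0 j + ∫ s in (0 : ℝ)..x, g s j

/-- The Dirichlet spectrum with base point `0`: the `μ ∈ ℂ` for which there is a nonzero
`v ∈ H¹([0, L], ℂ²)` with `ℒ v = i σ₃ (v_x - Q v) = μ v` and
`v₁ + v₂ = 0` at `0` and at `L`. -/
def dirichletSpectrum (u : ℝ → ℂ) (L : ℝ) : Set ℂ :=
  {μ | ∃ v g : ℝ → Fin 2 → ℂ, HasWeakDerivH1 L v g ∧ (∃ x ∈ Set.Icc 0 L, v x ≠ 0) ∧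
    (∀ᵐ x ∂(volume.restrict (Set.Icc 0 L)),
      (Complex.I • sigma3).mulVec (g x - (potentialMatrix u x).mulVec (v x)) = μ • v x) ∧
    v 0 0 + v 0 1 = 0 ∧ v L 0 + v L 1 = 0}

/-- The numbering `ζ₂ⱼ₋₁ ≤ μⱼ ≤ ζ₂ⱼ` of the Dirichlet eigenvalues (there is exactly one in each
closed gap). -/
def IsDirichletNumbering (u : ℝ → ℂ) (L : ℝ) (ζ μ : ℤ → ℝ) : Prop :=
  ∀ j : ℤ, (μ j : ℂ) ∈ dirichletSpectrum u L ∧ ζ (2 * j - 1) ≤ μ j ∧ μ j ≤ ζ (2 * j)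

/-- The matrix `U` of the similarity transformation. -/
def Umat : Matrix (Fin 2) (Fin 2) ℂ := !![1, 1; -Complex.I, Complex.I]

/-- The transformed fundamental solution `Ỹ(x, z) = U Y(x, z) U⁻¹`. -/
def Ytilde (u : ℝ → ℂ) (x : ℝ) (z : ℂ) : Matrix (Fin 2) (Fin 2) ℂ :=
  Umat * principalSolution u z x * Umat⁻¹

/-- `σ = - sgn log |ỹ₂₂(L, μ)|`. -/
def dirichletSign (u : ℝ → ℂ) (L : ℝ) (μ : ℂ) : ℝ :=
  -Real.sign (Real.log ‖Ytilde u L μ 1 1‖)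

/-- `∂ỹ₁₂(L, z)/∂z`. -/
def Ytilde12Deriv (u : ℝ → ℂ) (L : ℝ) (z : ℂ) : ℂ :=
  deriv (fun w : ℂ => Ytilde u L w 0 1) z

/-- `c₁(z)`, built from `u(0)` and `u_x(0)`. -/
def c1 (u : ℝ → ℂ) (z : ℂ) : ℂ :=
  -2 * z ^ 2 - Complex.I * z * (conj (u 0) - u 0) - (‖u 0‖ : ℂ) ^ 2
    - 1 / 2 * (deriv u 0 + conj (deriv u 0))

/-! ### The defocusing NLS equation -/

/-- `q(x, t)` is, for `t` in the time interval `J`, a classical `L`-periodic solution of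
`i q_t + q_xx - 2 |q|² q = 0`: it is `C²` in `x`, differentiable in `t`, and `q`, `q_x`, `q_xx`
(hence also `q_t`) are continuous in `(x, t)`. -/
structure IsNLSSolution (L : ℝ) (J : Set ℝ) (q : ℝ → ℝ → ℂ) : Prop where
  periodic : ∀ t ∈ J, ∀ x, q (x + L) t = q x t
  contDiff : ∀ t ∈ J, ContDiff ℝ 2 fun x => q x t
  continuousOn : ContinuousOn (fun p : ℝ × ℝ => q p.1 p.2) (Set.univ ×ˢ J)
  continuousOn_x :
    ContinuousOn (fun p : ℝ × ℝ => deriv (fun x => q x p.2) p.1) (Set.univ ×ˢ J)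
  continuousOn_xx :
    ContinuousOn (fun p : ℝ × ℝ => iteratedDeriv 2 (fun x => q x p.2) p.1) (Set.univ ×ˢ J)
  differentiableAt_t : ∀ t ∈ J, ∀ x, DifferentiableAt ℝ (fun s => q x s) t
  nls : ∀ t ∈ J, ∀ x, Complex.I * deriv (fun s => q x s) t
    + iteratedDeriv 2 (fun y => q y t) x - 2 * (‖q x t‖ : ℂ) ^ 2 * q x t = 0

end

end NLSDirichlet

namespace NLSDirichlet

noncomputable section

/-! A Dirichlet eigenvalue is a zero of `ỹ₁₂(L, ·)`, a linear functional `tildeEntry12` of the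
monodromy M(t, z). Everything rests on the exact expansion `monodromy_expansion`, M(t, z) - M(s, w)
= (z - w) a + (t - s) b with a and b continuous at (s, w). It comes from variation of constants and
a Grönwall bound. By the zero-curvature form of NLS, b(s, w) is the commutator [B, M] with the time
matrix B of the Lax pair at x = 0.

A commutator has trace zero, so Δ is conserved (`discriminant_eq`), and since Δ determines the
numbering, the closed gaps do not move. On an interval with |Δ| ≥ 1 the function `ỹ₁₂` has at most
one zero, because at each zero its z-derivative is `ỹ₁₁` times a positive integral and `ỹ₁₁` has the
sign of Δ there. Compactness of the gap then makes μₙ continuous.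

Applying the functional to the expansion along (t, μₙ(t)) gives 0 = (μₙ(t) - μₙ(s)) ã₁₂ + (t - s)
b̃₁₂, hence μₙ' = -b̃₁₂ / ã₁₂, with no implicit function theorem. Here ã₁₂ is the z-derivative of
`ỹ₁₂`, and -b̃₁₂ = c₁ (`ỹ₂₂` - `ỹ₁₁`) by `tildeEntry12_commutator`. The numbers `ỹ₁₁` and `ỹ₂₂` are
the two Floquet multipliers, and σₙ records which of them is ρ (`dirichletSign_mul_rho`). -/

/-! ### Linear systems: stability, the inverse solution, variation of constants. -/

/-- Grönwall: `Y` solves the equation of `Z` up to the error (A - B) Y, of norm at most ε C. Only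
`Y` needs an a priori bound. -/
theorem norm_sub_le_of_linear_ode {R : Type*} [NormedRing R] [NormedAlgebra ℝ R]
    {A B Y Z : ℝ → R} {L K ε C : ℝ} (hK : 0 < K)
    (hB : ∀ x ∈ Set.Icc 0 L, ‖B x‖ ≤ K) (hAB : ∀ x ∈ Set.Icc 0 L, ‖A x - B x‖ ≤ ε)
    (hC : ∀ x ∈ Set.Icc 0 L, ‖Y x‖ ≤ C) (hε : 0 ≤ ε) (hC0 : 0 ≤ C)
    (hY : ∀ x, HasDerivAt Y (A x * Y x) x) (hZ : ∀ x, HasDerivAt Z (B x * Z x) x)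
    (h0 : Y 0 = Z 0) :
    ∀ x ∈ Set.Icc 0 L, ‖Y x - Z x‖ ≤ C / K * Real.exp (K * L) * ε := by
  intro x hx
  have hL : 0 ≤ L := hx.1.trans hx.2
  have h := dist_le_of_approx_trajectories_ODE_of_mem (v := fun s y => B s * y)
    (s := fun _ => Set.univ) (K := K.toNNReal) (f := Y) (g := Z)
    (f' := fun s => A s * Y s) (g' := fun s => B s * Z s) (a := 0) (b := L)
    (εf := ε * C) (εg := 0) (δ := 0)
    (fun t ht => by
      refine LipschitzOnWith.of_dist_le_mul fun y _ z _ => ?_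
      rw [dist_eq_norm, dist_eq_norm, ← mul_sub]
      refine (norm_mul_le _ _).trans ?_
      gcongr
      exact (hB t ⟨ht.1, ht.2.le⟩).trans (Real.le_coe_toNNReal _))
    (fun t _ => (hY t).continuousAt.continuousWithinAt)
    (fun t _ => (hY t).hasDerivWithinAt)
    (fun t ht => by
      rw [dist_eq_norm, ← sub_mul]
      refine (norm_mul_le _ _).trans ?_
      gcongr
      · exact hAB t ⟨ht.1, ht.2.le⟩
      · exact hC t ⟨ht.1, ht.2.le⟩)
    (fun _ _ => trivial)
    (fun t _ => (hZ t).continuousAt.continuousWithinAt)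
    (fun t _ => (hZ t).hasDerivWithinAt)
    (fun t ht => by simp)
    (fun _ _ => trivial) (by simp [h0]) x hx
  rw [dist_eq_norm, Real.coe_toNNReal _ hK.le, gronwallBound_of_K_ne_0 hK.ne', sub_zero] at h
  refine h.trans ?_
  have h1 : Real.exp (K * x) - 1 ≤ Real.exp (K * L) := by
    have : Real.exp (K * x) ≤ Real.exp (K * L) :=
      Real.exp_le_exp.2 (mul_le_mul_of_nonneg_left hx.2 hK.le)
    linarith
  have h2 : 0 ≤ ε * C / K := by positivity
  calc 0 * Real.exp (K * x) + (ε * C + 0) / K * (Real.exp (K * x) - 1)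
      = ε * C / K * (Real.exp (K * x) - 1) := by ring
    _ ≤ ε * C / K * Real.exp (K * L) := mul_le_mul_of_nonneg_left h1 h2
    _ = _ := by ring

/-- Variation of constants: `W` is the inverse of a solution of `Y' = B Y`. -/
theorem integral_variation_of_constants {R : Type*} [NormedRing R] [NormedAlgebra ℝ R]
    [CompleteSpace R] {A B Y W : ℝ → R} (hA : Continuous A) (hB : Continuous B)
    (hY : ∀ x, HasDerivAt Y (A x * Y x) x) (hW : ∀ x, HasDerivAt W (-(W x * B x)) x) (L : ℝ) :
    ∫ x in (0 : ℝ)..L, W x * (A x - B x) * Y x = W L * Y L - W 0 * Y 0 := by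
  have hYc : Continuous Y := continuous_iff_continuousAt.2 fun x => (hY x).continuousAt
  have hWc : Continuous W := continuous_iff_continuousAt.2 fun x => (hW x).continuousAt
  refine intervalIntegral.integral_eq_sub_of_hasDerivAt (f := fun x => W x * Y x)
    (fun x _ => ?_) (Continuous.intervalIntegrable (by fun_prop) _ _)
  exact ((hW x).mul (hY x)).congr_deriv (by noncomm_ring)

section

attribute [local instance] Matrix.linftyOpNormedRing Matrix.linftyOpNormedAlgebra

local notation "Mat" => Matrix (Fin 2) (Fin 2) ℂ

theorem hasDerivAt_matrix {Y : ℝ → Mat} {Y' : Mat} {x : ℝ}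
    (h : ∀ i j, HasDerivAt (fun s => Y s i j) (Y' i j) x) : HasDerivAt Y Y' x := by
  have h2 : HasDerivAt
      (fun s => ∑ i : Fin 2, ∑ j : Fin 2, Y s i j • Matrix.single i j (1 : ℂ))
      (∑ i : Fin 2, ∑ j : Fin 2, Y' i j • Matrix.single i j (1 : ℂ)) x :=
    HasDerivAt.fun_sum fun i _ => HasDerivAt.fun_sum fun j _ => (h i j).smul_const _
  have h3 : ∀ M : Mat, ∑ i : Fin 2, ∑ j : Fin 2, M i j • Matrix.single i j (1 : ℂ) = M := by
    intro M
    conv_rhs => rw [Matrix.matrix_eq_sum_single M]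
    simp [Matrix.smul_single]
  simpa only [h3] using h2

theorem norm_matrix_le {M : Mat} {c : ℝ} (h : ∀ i, ‖M i 0‖ + ‖M i 1‖ ≤ c) : ‖M‖ ≤ c := by
  have hc : 0 ≤ c := (by positivity : 0 ≤ ‖M 0 0‖ + ‖M 0 1‖).trans (h 0)
  lift c to NNReal using hc
  rw [Matrix.linfty_opNorm_def]
  norm_cast
  refine Finset.sup_le fun i _ => ?_
  rw [Fin.sum_univ_two]
  exact_mod_cast h i

theorem norm_potentialMatrix_le (u : ℝ → ℂ) (x : ℝ) : ‖potentialMatrix u x‖ ≤ ‖u x‖ := by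
  refine norm_matrix_le fun i => ?_
  fin_cases i <;> simp [potentialMatrix]

theorem norm_sigma3_le : ‖sigma3‖ ≤ 1 := by
  refine norm_matrix_le fun i => ?_
  fin_cases i <;> simp [sigma3]

/-- The inverse of the principal solution (as `det Y = 1`). -/
def inverseSolution (u : ℝ → ℂ) (z : ℂ) (x : ℝ) : Mat := (principalSolution u z x).adjugate

section principal

variable {u : ℝ → ℂ} (hu : Continuous u) (z : ℂ)
include hu

theorem principalSolution_zero : principalSolution u z 0 = 1 :=
  (isPrincipalSolution_principalSolution hu z).1

theorem principalSolution_hasDerivAt (x : ℝ) :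
    HasDerivAt (principalSolution u z) (zsMatrix u z x * principalSolution u z x) x :=
  (isPrincipalSolution_iff.1 (isPrincipalSolution_principalSolution hu z)).2 x

theorem principalSolution_continuous : Continuous (principalSolution u z) :=
  continuous_iff_continuousAt.2 fun x => (principalSolution_hasDerivAt hu z x).continuousAt

theorem inverseSolution_hasDerivAt (x : ℝ) :
    HasDerivAt (inverseSolution u z) (-(inverseSolution u z x * zsMatrix u z x)) x := by
  have h := (isPrincipalSolution_principalSolution hu z).2 x
  refine hasDerivAt_matrix fun i j => ?_
  unfold inverseSolution
  simp only [Matrix.adjugate_fin_two]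
  fin_cases i <;> fin_cases j
  · refine (h 1 1).congr_deriv ?_
    simp [zsMatrix, sigma3, potentialMatrix, Matrix.mul_apply, Fin.sum_univ_two]; ring
  · refine (h 0 1).neg.congr_deriv ?_
    simp [zsMatrix, sigma3, potentialMatrix, Matrix.mul_apply, Fin.sum_univ_two]; ring
  · refine (h 1 0).neg.congr_deriv ?_
    simp [zsMatrix, sigma3, potentialMatrix, Matrix.mul_apply, Fin.sum_univ_two]; ring
  · refine (h 0 0).congr_deriv ?_
    simp [zsMatrix, sigma3, potentialMatrix, Matrix.mul_apply, Fin.sum_univ_two]; ring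

theorem inverseSolution_continuous : Continuous (inverseSolution u z) :=
  continuous_iff_continuousAt.2 fun x => (inverseSolution_hasDerivAt hu z x).continuousAt

theorem inverseSolution_zero : inverseSolution u z 0 = 1 := by
  rw [inverseSolution, principalSolution_zero hu, Matrix.adjugate_one]

/-- The product has derivative zero. As the left factor is an adjugate, this also yields det Y = 1.
-/
theorem inverseSolution_mul (x : ℝ) : inverseSolution u z x * principalSolution u z x = 1 := by
  have hd : ∀ y, HasDerivAt (fun y => inverseSolution u z y * principalSolution u z y) 0 y := by
    intro y
    exact ((inverseSolution_hasDerivAt hu z y).mul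
      (principalSolution_hasDerivAt hu z y)).congr_deriv (by noncomm_ring)
  have := is_const_of_deriv_eq_zero (fun y => (hd y).differentiableAt) (fun y => (hd y).deriv) x 0
  simpa [inverseSolution_zero hu, principalSolution_zero hu] using this

theorem det_principalSolution (x : ℝ) : (principalSolution u z x).det = 1 := by
  have h := inverseSolution_mul hu z x
  rw [inverseSolution, Matrix.adjugate_mul] at h
  simpa using congrFun (congrFun h 0) 0

theorem mul_inverseSolution (x : ℝ) : principalSolution u z x * inverseSolution u z x = 1 := by
  rw [inverseSolution, Matrix.mul_adjugate, det_principalSolution hu, one_smul]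

/-- An exact identity, not a first-order one, because the integrand keeps the perturbed solution on
the right. It is the source of the divided differences of the monodromy. -/
theorem monodromy_sub_eq {v : ℝ → ℂ} (hv : Continuous v) (w : ℂ) (L : ℝ) :
    monodromy v L w - monodromy u L z = monodromy u L z *
      ∫ x in (0 : ℝ)..L, inverseSolution u z x * (zsMatrix v w x - zsMatrix u z x)
        * principalSolution v w x := by
  rw [integral_variation_of_constants (zsMatrix_continuous hv w) (zsMatrix_continuous hu z)
    (principalSolution_hasDerivAt hv w) (inverseSolution_hasDerivAt hu z),
    inverseSolution_zero hu, principalSolution_zero hv, mul_sub, mul_one, mul_one, ← mul_assoc]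
  rw [monodromy, monodromy, mul_inverseSolution hu, one_mul]

end principal

end

/-- Dominated convergence: pointwise continuity in the parameter and local uniform bounds on the
period suffice. -/
theorem continuousAt_integral_mul_mul {R P : Type*} [NormedRing R] [NormedAlgebra ℝ R]
    [CompleteSpace R] [TopologicalSpace P] [FirstCountableTopology P] {W : ℝ → R}
    {G Y : P → ℝ → R} {p₀ : P} {L g c : ℝ}
    (hL : 0 ≤ L) (hW : Continuous W)
    (hG : ∀ᶠ p in 𝓝 p₀, Continuous (G p)) (hY : ∀ᶠ p in 𝓝 p₀, Continuous (Y p))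
    (hGb : ∀ᶠ p in 𝓝 p₀, ∀ x ∈ Set.Icc 0 L, ‖G p x‖ ≤ g)
    (hYb : ∀ᶠ p in 𝓝 p₀, ∀ x ∈ Set.Icc 0 L, ‖Y p x‖ ≤ c)
    (hGc : ∀ x ∈ Set.Icc 0 L, ContinuousAt (fun p => G p x) p₀)
    (hYc : ∀ x ∈ Set.Icc 0 L, ContinuousAt (fun p => Y p x) p₀) :
    ContinuousAt (fun p => ∫ x in (0 : ℝ)..L, W x * G p x * Y p x) p₀ := by
  have hsub : Set.uIoc 0 L ⊆ Set.Icc 0 L := by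
    rw [Set.uIoc_of_le hL]; exact Set.Ioc_subset_Icc_self
  refine intervalIntegral.continuousAt_of_dominated_interval (bound := fun x => ‖W x‖ * g * c)
    ?_ ?_ ?_ ?_
  · filter_upwards [hG, hY] with p h1 h2
    exact ((hW.mul h1).mul h2).aestronglyMeasurable
  · filter_upwards [hGb, hYb] with p h1 h2
    refine Eventually.of_forall fun x hx => ?_
    have hx' := hsub hx
    have h3 : 0 ≤ g := (norm_nonneg _).trans (h1 x hx')
    refine (norm_mul_le _ _).trans ?_
    gcongr
    · refine (norm_mul_le _ _).trans ?_
      gcongr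
      exact h1 x hx'
    · exact h2 x hx'
  · exact ((hW.norm.mul continuous_const).mul continuous_const).intervalIntegrable _ _
  · refine Eventually.of_forall fun x hx => ?_
    exact (continuousAt_const.mul (hGc x (hsub hx))).mul (hYc x (hsub hx))

/-! ### The Lax pair and the first variation of the monodromy. -/

section

attribute [local instance] Matrix.linftyOpNormedRing Matrix.linftyOpNormedAlgebra

local notation "Mat" => Matrix (Fin 2) (Fin 2) ℂ

theorem potentialMatrix_continuous {u : ℝ → ℂ} (hu : Continuous u) :
    Continuous (potentialMatrix u) := by
  refine continuous_matrix fun i j => ?_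
  fin_cases i <;> fin_cases j <;> simp [potentialMatrix] <;> fun_prop

theorem norm_zsMatrix_sub_le (u v : ℝ → ℂ) (z w : ℂ) (x : ℝ) :
    ‖zsMatrix u z x - zsMatrix v w x‖ ≤ ‖z - w‖ + ‖u x - v x‖ := by
  have h : zsMatrix u z x - zsMatrix v w x
      = (-(Complex.I * (z - w))) • sigma3 + potentialMatrix (fun y => u y - v y) x := by
    ext i j
    fin_cases i <;> fin_cases j <;> simp [zsMatrix, sigma3, potentialMatrix] <;> ring
  rw [h]
  refine (norm_add_le _ _).trans (add_le_add ?_ (norm_potentialMatrix_le _ _))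
  refine (norm_smul_le _ _).trans ?_
  refine (mul_le_mul_of_nonneg_left norm_sigma3_le (norm_nonneg _)).trans ?_
  simp

/-- The matrix of the time part of the Lax pair of the defocusing NLS equation. -/
def laxTimeMatrix (u : ℝ → ℂ) (z : ℂ) (x : ℝ) : Mat :=
  !![-2 * Complex.I * z ^ 2 - Complex.I * (u x * conj (u x)), 2 * z * u x + Complex.I * deriv u x;
     2 * z * conj (u x) - Complex.I * conj (deriv u x),
     2 * Complex.I * z ^ 2 + Complex.I * (u x * conj (u x))]

/-- The zero-curvature form of the defocusing NLS equation. -/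
theorem laxTimeMatrix_hasDerivAt {u : ℝ → ℂ} (hu : ContDiff ℝ 2 u) (z : ℂ) (x : ℝ) {d : ℂ}
    (hd : Complex.I * d + iteratedDeriv 2 u x - 2 * (‖u x‖ : ℂ) ^ 2 * u x = 0) :
    HasDerivAt (laxTimeMatrix u z) (potentialMatrix (fun _ => d) x
      - laxTimeMatrix u z x * zsMatrix u z x + zsMatrix u z x * laxTimeMatrix u z x) x := by
  have h0 : HasDerivAt u (deriv u x) x := (hu.differentiable (by norm_num) x).hasDerivAt
  have h1 : HasDerivAt (deriv u) (iteratedDeriv 2 u x) x := by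
    have h : ContDiff ℝ 1 (deriv u) := ((contDiff_succ_iff_deriv (n := 1)).1 hu).2.2
    rw [iteratedDeriv_succ, iteratedDeriv_one]
    exact (h.differentiable (by norm_num) x).hasDerivAt
  have hc0 : HasDerivAt (fun y => conj (u y)) (conj (deriv u x)) x := h0.star
  have hc1 : HasDerivAt (fun y => conj (deriv u y)) (conj (iteratedDeriv 2 u x)) x := h1.star
  have hn : (‖u x‖ : ℂ) ^ 2 = u x * conj (u x) := (Complex.mul_conj' _).symm
  rw [hn] at hd
  have hI : Complex.I ^ 2 = -1 := Complex.I_sq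
  -- The lower left entry of the zero-curvature equation is the complex conjugate of NLS.
  have hdc : -Complex.I * conj d + conj (iteratedDeriv 2 u x)
      - 2 * (u x * conj (u x)) * conj (u x) = 0 := by
    have := congrArg conj hd
    simp only [map_sub, map_add, map_mul, map_zero, Complex.conj_I, Complex.conj_conj,
      map_ofNat] at this
    linear_combination this
  refine hasDerivAt_matrix fun i j => ?_
  fin_cases i <;> fin_cases j
  · refine (((h0.mul hc0).const_mul Complex.I).const_sub
      (-2 * Complex.I * z ^ 2)).congr_deriv ?_
    simp [zsMatrix, sigma3, potentialMatrix, laxTimeMatrix]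
    ring
  · refine ((h0.const_mul (2 * z)).add (h1.const_mul Complex.I)).congr_deriv ?_
    simp [zsMatrix, sigma3, potentialMatrix, laxTimeMatrix]
    linear_combination Complex.I * hd + (2 * z * deriv u x - d) * hI
  · refine ((hc0.const_mul (2 * z)).sub (hc1.const_mul Complex.I)).congr_deriv ?_
    simp [zsMatrix, sigma3, potentialMatrix, laxTimeMatrix]
    linear_combination -Complex.I * hdc + (2 * z * conj (deriv u x) - conj d) * hI
  · refine (((h0.mul hc0).const_mul Complex.I).const_add
      (2 * Complex.I * z ^ 2)).congr_deriv ?_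
    simp [zsMatrix, sigma3, potentialMatrix, laxTimeMatrix]
    ring

theorem trace_commutator (A B : Mat) : (A * B - B * A).trace = 0 := by
  rw [Matrix.trace_sub, Matrix.trace_mul_comm, sub_self]

/-- If `d` is the time derivative prescribed by the NLS equation, the first variation of the
monodromy in the direction `d` is a commutator. -/
theorem monodromy_variation_eq_commutator {u d : ℝ → ℂ} (hu : ContDiff ℝ 2 u)
    (hd : ∀ x, Complex.I * d x + iteratedDeriv 2 u x - 2 * (‖u x‖ : ℂ) ^ 2 * u x = 0)
    (hdc : Continuous d) {L : ℝ} (hper : ∀ x, u (x + L) = u x) (z : ℂ) :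
    monodromy u L z * ∫ x in (0 : ℝ)..L, inverseSolution u z x * potentialMatrix d x
        * principalSolution u z x
      = laxTimeMatrix u z 0 * monodromy u L z - monodromy u L z * laxTimeMatrix u z 0 := by
  have huc := hu.continuous
  have hint := intervalIntegral.integral_eq_sub_of_hasDerivAt (a := 0) (b := L)
    (f := fun x => inverseSolution u z x * laxTimeMatrix u z x * principalSolution u z x)
    (f' := fun x => inverseSolution u z x * potentialMatrix d x * principalSolution u z x)
    -- In the derivative of W B Y the terms W A B and W B A cancel against the commutator in B',
    -- which leaves W Q(d) Y.
    (fun x _ => by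
      refine (((inverseSolution_hasDerivAt huc z x).mul
        (laxTimeMatrix_hasDerivAt hu z x (hd x))).mul
        (principalSolution_hasDerivAt huc z x)).congr_deriv ?_
      change _ = inverseSolution u z x * potentialMatrix (fun _ => d x) x * _
      simp only [Pi.mul_apply]
      noncomm_ring)
    ((((inverseSolution_continuous huc z).mul (potentialMatrix_continuous hdc)).mul
      (principalSolution_continuous huc z)).intervalIntegrable _ _)
  -- Periodicity is what turns the two boundary terms into a commutator with a single matrix.
  have hB : laxTimeMatrix u z L = laxTimeMatrix u z 0 := by
    have h1 : u L = u 0 := by simpa using hper 0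
    have h2 : deriv u L = deriv u 0 := by
      have : (fun x => u (x + L)) = u := funext hper
      have h3 := deriv_comp_add_const u L 0
      rw [this, zero_add] at h3
      exact h3.symm
    simp only [laxTimeMatrix, h1, h2]
  rw [hint, hB, inverseSolution_zero huc, principalSolution_zero huc, one_mul, mul_one, mul_sub,
    ← mul_assoc, ← mul_assoc]
  rw [monodromy, mul_inverseSolution huc, one_mul]

/-! ### Joint dependence of the monodromy on time and spectral parameter. -/

namespace IsNLSSolution

variable {L : ℝ} {J : Set ℝ} {q : ℝ → ℝ → ℂ} (hq : IsNLSSolution L J q)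
include hq

theorem continuous {t : ℝ} (ht : t ∈ J) : Continuous fun x => q x t := (hq.contDiff t ht).continuous

/-- The equation gives q_t = i (q_xx - 2 |q|² q), and the right side is continuous by assumption. -/
theorem continuousOn_t :
    ContinuousOn (fun p : ℝ × ℝ => deriv (fun s => q p.1 s) p.2) (Set.univ ×ˢ J) := by
  have h : ContinuousOn (fun p : ℝ × ℝ => Complex.I * (iteratedDeriv 2 (fun x => q x p.2) p.1
      - 2 * (‖q p.1 p.2‖ : ℂ) ^ 2 * q p.1 p.2)) (Set.univ ×ˢ J) := by
    have h1 := hq.continuousOn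
    have h2 : ContinuousOn (fun p : ℝ × ℝ => (‖q p.1 p.2‖ : ℂ)) (Set.univ ×ˢ J) :=
      Complex.continuous_ofReal.comp_continuousOn h1.norm
    exact continuousOn_const.mul
      (hq.continuousOn_xx.sub ((continuousOn_const.mul (h2.pow 2)).mul h1))
  refine h.congr fun p hp => ?_
  linear_combination (-Complex.I) * hq.nls p.2 hp.2 p.1
    + deriv (fun s => q p.1 s) p.2 * Complex.I_sq

theorem continuous_deriv_t {t : ℝ} (ht : t ∈ J) : Continuous fun x => deriv (fun s => q x s) t :=
  hq.continuousOn_t.comp_continuous (f := fun x : ℝ => (x, t)) (by fun_prop)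
    fun _ => ⟨trivial, ht⟩

theorem continuous_dslope {s t : ℝ} (hs : s ∈ J) (ht : t ∈ J) :
    Continuous fun x => dslope (q x) s t := by
  rcases eq_or_ne t s with rfl | h
  · simpa only [dslope_same] using hq.continuous_deriv_t hs
  · simp only [dslope_of_ne _ h, slope, vsub_eq_sub]
    exact ((hq.continuous ht).sub (hq.continuous hs)).const_smul _

/-- Locally in time, the solution is Lipschitz in time, uniformly on a period. -/
theorem exists_lipschitz (hJ : IsOpen J) {s : ℝ} (hs : s ∈ J) :
    ∃ r > 0, ∃ C ≥ 0, ∀ t, |t - s| < r → t ∈ J ∧ ∀ x ∈ Set.Icc 0 L,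
      ‖q x t - q x s‖ ≤ C * |t - s| ∧ ‖dslope (q x) s t‖ ≤ C := by
  obtain ⟨r, hr, hrJ⟩ := Metric.nhds_basis_closedBall.mem_iff.1 (hJ.mem_nhds hs)
  have hK : IsCompact (Set.Icc 0 L ×ˢ Metric.closedBall s r) :=
    isCompact_Icc.prod (isCompact_closedBall s r)
  obtain ⟨C, hC⟩ := hK.exists_bound_of_continuousOn
    (hq.continuousOn_t.mono (Set.prod_mono (Set.subset_univ _) hrJ))
  refine ⟨r, hr, max C 0, le_max_right _ _, fun t ht => ?_⟩
  have htb : t ∈ Metric.closedBall s r := by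
    rw [Metric.mem_closedBall, Real.dist_eq]; exact ht.le
  have hsb : s ∈ Metric.closedBall s r := Metric.mem_closedBall_self hr.le
  refine ⟨hrJ htb, fun x hx => ?_⟩
  have hlip : ‖q x t - q x s‖ ≤ max C 0 * |t - s| :=
    (convex_closedBall s r).norm_image_sub_le_of_norm_deriv_le (f := q x)
      (fun y hy => hq.differentiableAt_t y (hrJ hy) x)
      (fun y hy => (hC (x, y) ⟨hx, hy⟩).trans (le_max_left _ _)) hsb htb
  refine ⟨hlip, ?_⟩
  rcases eq_or_ne t s with rfl | h
  · rw [dslope_same]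
    exact (hC (x, t) ⟨hx, htb⟩).trans (le_max_left _ _)
  · have h0 : 0 < |t - s| := abs_pos.2 (sub_ne_zero.2 h)
    rw [dslope_of_ne _ h, slope, vsub_eq_sub, norm_smul, norm_inv, Real.norm_eq_abs,
      inv_mul_le_iff₀ h0, mul_comm]
    exact hlip

/-- The principal solution is locally Lipschitz in `(t, z)`, uniformly on a period. -/
theorem principalSolution_lipschitz (hJ : IsOpen J) {s : ℝ} (hs : s ∈ J) (w : ℂ) :
    ∃ D : ℝ, ∀ᶠ p : ℝ × ℂ in 𝓝 (s, w), ∀ x ∈ Set.Icc 0 L,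
      ‖principalSolution (fun y => q y s) w x - principalSolution (fun y => q y p.1) p.2 x‖
        ≤ D * (‖p.2 - w‖ + |p.1 - s|) := by
  obtain ⟨r, hr, C, hC0, hC⟩ := hq.exists_lipschitz hJ hs
  have hqs := hq.continuous hs
  obtain ⟨c, hc⟩ := (isCompact_Icc (a := (0 : ℝ)) (b := L)).exists_bound_of_continuousOn
    (principalSolution_continuous hqs w).continuousOn
  obtain ⟨k, hk⟩ := (isCompact_Icc (a := (0 : ℝ)) (b := L)).exists_bound_of_continuousOn
    (zsMatrix_continuous hqs w).continuousOn
  set c' := max c 0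
  -- A bound for the perturbed coefficient matrix: k at (s, w), plus 1 for |z - w| < 1, plus C r for
  -- the change of q in time.
  set K := max k 0 + (1 + C * r)
  have hK : 0 < K := by positivity
  refine ⟨c' / K * Real.exp (K * L) * (1 + C), ?_⟩
  have h1 : ∀ᶠ p : ℝ × ℂ in 𝓝 (s, w), |p.1 - s| < r :=
    (continuous_fst.tendsto (s, w)).eventually (eventually_abs_sub_lt s hr)
  have h2 : ∀ᶠ p : ℝ × ℂ in 𝓝 (s, w), ‖p.2 - w‖ < 1 :=
    ((continuous_snd.tendsto (s, w)).eventually (Metric.ball_mem_nhds w one_pos)).mono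
      fun p hp => by rwa [← dist_eq_norm]
  filter_upwards [h1, h2] with p hp1 hp2
  obtain ⟨hpJ, hpC⟩ := hC p.1 hp1
  have hdiff : ∀ x ∈ Set.Icc 0 L, ‖zsMatrix (fun y => q y s) w x
      - zsMatrix (fun y => q y p.1) p.2 x‖ ≤ ‖p.2 - w‖ + C * |p.1 - s| := fun x hx => by
    rw [norm_sub_rev]
    exact (norm_zsMatrix_sub_le _ _ _ _ _).trans (add_le_add_right (hpC x hx).1 _)
  intro x hx
  have key := norm_sub_le_of_linear_ode (C := c') hK (fun x hx => ?_) hdiff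
    (fun x hx => (hc x hx).trans (le_max_left _ _))
    (by positivity) (le_max_right _ _) (principalSolution_hasDerivAt hqs w)
    (principalSolution_hasDerivAt (hq.continuous hpJ) p.2)
    (by rw [principalSolution_zero hqs, principalSolution_zero (hq.continuous hpJ)]) x hx
  · refine key.trans ?_
    rw [mul_assoc _ (1 + C)]
    gcongr
    nlinarith [norm_nonneg (p.2 - w), abs_nonneg (p.1 - s)]
  · have h3 := hdiff x hx
    have h4 := hk x hx
    have h5 := norm_sub_norm_le (zsMatrix (fun y => q y p.1) p.2 x) (zsMatrix (fun y => q y s) w x)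
    rw [norm_sub_rev] at h5
    have h6 : C * |p.1 - s| ≤ C * r := by gcongr
    have := le_max_left k 0
    linarith

/-- The monodromy is differentiable in `(t, z)`, with `∂M/∂t` given by the Lax equation. -/
theorem monodromy_expansion (hL : 0 ≤ L) (hJ : IsOpen J) {s : ℝ} (hs : s ∈ J) (w : ℂ) :
    ∃ a b : ℝ × ℂ → Mat, ContinuousAt a (s, w) ∧ ContinuousAt b (s, w) ∧
      a (s, w) = monodromy (fun y => q y s) L w * ∫ x in (0 : ℝ)..L,
        inverseSolution (fun y => q y s) w x * (-Complex.I • sigma3)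
          * principalSolution (fun y => q y s) w x ∧
      b (s, w) = laxTimeMatrix (fun y => q y s) w 0 * monodromy (fun y => q y s) L w
        - monodromy (fun y => q y s) L w * laxTimeMatrix (fun y => q y s) w 0 ∧
      ∀ᶠ p in 𝓝 (s, w), monodromy (fun y => q y p.1) L p.2 - monodromy (fun y => q y s) L w
        = (p.2 - w) • a p + ((p.1 - s : ℝ) : ℂ) • b p := by
  obtain ⟨r, hr, C, hC0, hC⟩ := hq.exists_lipschitz hJ hs
  obtain ⟨D, hD⟩ := hq.principalSolution_lipschitz hJ hs w
  have hqs := hq.continuous hs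
  obtain ⟨c, hc⟩ := (isCompact_Icc (a := (0 : ℝ)) (b := L)).exists_bound_of_continuousOn
    (principalSolution_continuous hqs w).continuousOn
  have h1 : ∀ᶠ p : ℝ × ℂ in 𝓝 (s, w), |p.1 - s| < r :=
    (continuous_fst.tendsto (s, w)).eventually (eventually_abs_sub_lt s hr)
  have hlim : Tendsto (fun p : ℝ × ℂ => D * (‖p.2 - w‖ + |p.1 - s|)) (𝓝 (s, w)) (𝓝 0) := by
    have : Continuous fun p : ℝ × ℂ => D * (‖p.2 - w‖ + |p.1 - s|) := by fun_prop
    simpa using this.tendsto (s, w)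
  have hYc : ∀ᶠ p : ℝ × ℂ in 𝓝 (s, w), Continuous (principalSolution (fun y => q y p.1) p.2) := by
    filter_upwards [h1] with p hp
    exact principalSolution_continuous (hq.continuous (hC p.1 hp).1) p.2
  have hYb : ∀ᶠ p : ℝ × ℂ in 𝓝 (s, w), ∀ x ∈ Set.Icc 0 L,
      ‖principalSolution (fun y => q y p.1) p.2 x‖ ≤ c + 1 := by
    filter_upwards [hD, hlim.eventually (gt_mem_nhds one_pos)] with p h2 h3 x hx
    have h4 := norm_sub_norm_le (principalSolution (fun y => q y p.1) p.2 x)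
      (principalSolution (fun y => q y s) w x)
    rw [norm_sub_rev] at h4
    linarith [h2 x hx, hc x hx]
  have hYt : ∀ x ∈ Set.Icc 0 L,
      ContinuousAt (fun p : ℝ × ℂ => principalSolution (fun y => q y p.1) p.2 x) (s, w) := by
    intro x hx
    refine tendsto_iff_norm_sub_tendsto_zero.2 ?_
    refine squeeze_zero' (Eventually.of_forall fun _ => norm_nonneg _) ?_ hlim
    filter_upwards [hD] with p h2
    rw [norm_sub_rev]
    exact h2 x hx
  have hWc := inverseSolution_continuous hqs w
  have hGc : ∀ᶠ p : ℝ × ℂ in 𝓝 (s, w),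
      Continuous (potentialMatrix fun y => dslope (q y) s p.1) := by
    filter_upwards [h1] with p hp
    exact potentialMatrix_continuous (hq.continuous_dslope hs (hC p.1 hp).1)
  have hGb : ∀ᶠ p : ℝ × ℂ in 𝓝 (s, w), ∀ x ∈ Set.Icc 0 L,
      ‖potentialMatrix (fun y => dslope (q y) s p.1) x‖ ≤ C := by
    filter_upwards [h1] with p hp x hx
    exact (norm_potentialMatrix_le _ _).trans ((hC p.1 hp).2 x hx).2
  have hGt : ∀ x ∈ Set.Icc 0 L, ContinuousAt
      (fun p : ℝ × ℂ => potentialMatrix (fun y => dslope (q y) s p.1) x) (s, w) := by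
    intro x _
    have h2 : ContinuousAt (fun p : ℝ × ℂ => dslope (q x) s p.1) (s, w) :=
      (continuousAt_dslope_same.2 (hq.differentiableAt_t s hs x)).tendsto.comp
        (continuous_fst.tendsto (s, w))
    have h3 : Continuous fun d : ℂ => potentialMatrix (fun _ => d) 0 := by
      refine continuous_matrix fun i j => ?_
      fin_cases i <;> fin_cases j <;> simp [potentialMatrix] <;> fun_prop
    exact (h3.tendsto _).comp h2
  have hbc := continuousAt_integral_mul_mul (p₀ := (s, w))
    (G := fun p : ℝ × ℂ => potentialMatrix fun y => dslope (q y) s p.1)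
    (Y := fun p : ℝ × ℂ => principalSolution (fun y => q y p.1) p.2) hL hWc hGc hYc hGb hYb hGt hYt
  -- The coefficient matrices at p and at (s, w) differ by (z - w)(-iσ₃) + (t - s) Q(`dslope`); the
  -- two terms of the variation-of-constants integral are a and b. Using `dslope` gives b the value
  -- with q_t at t = s.
  refine ⟨fun p => monodromy (fun y => q y s) L w * ∫ x in (0 : ℝ)..L,
      inverseSolution (fun y => q y s) w x * (-Complex.I • sigma3)
        * principalSolution (fun y => q y p.1) p.2 x,
    fun p => monodromy (fun y => q y s) L w * ∫ x in (0 : ℝ)..L,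
      inverseSolution (fun y => q y s) w x * potentialMatrix (fun y => dslope (q y) s p.1) x
        * principalSolution (fun y => q y p.1) p.2 x, ?_, ?_, rfl, ?_, ?_⟩
  · exact continuousAt_const.mul (continuousAt_integral_mul_mul
      (G := fun _ _ => -Complex.I • sigma3) hL hWc (Eventually.of_forall fun _ => continuous_const)
      hYc (Eventually.of_forall fun _ _ _ => le_rfl) hYb (fun _ _ => continuousAt_const) hYt)
  · exact continuousAt_const.mul hbc
  · refine (Eq.trans ?_ (monodromy_variation_eq_commutator (hq.contDiff s hs)
      (fun x => hq.nls s hs x) (hq.continuous_deriv_t hs) (hq.periodic s hs) w))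
    simp only [dslope_same]
  · filter_upwards [h1, hYc, hGc] with p hp hpY hpG
    have hpJ := (hC p.1 hp).1
    rw [monodromy_sub_eq hqs w (hq.continuous hpJ) p.2 L, ← mul_smul_comm, ← mul_smul_comm,
      ← mul_add, ← intervalIntegral.integral_smul, ← intervalIntegral.integral_smul,
      ← intervalIntegral.integral_add]
    · congr 1
      refine intervalIntegral.integral_congr fun x _ => ?_
      have h2 : zsMatrix (fun y => q y p.1) p.2 x - zsMatrix (fun y => q y s) w x
          = (p.2 - w) • (-Complex.I • sigma3)
            + ((p.1 - s : ℝ) : ℂ) • potentialMatrix (fun y => dslope (q y) s p.1) x := by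
        have h3 : q x p.1 - q x s = ((p.1 - s : ℝ) : ℂ) * dslope (q x) s p.1 := by
          rw [← sub_smul_dslope, Complex.real_smul]
        -- The time increment is real, so it factors out of the conjugate entry too.
        have h4 : conj (q x p.1) - conj (q x s)
            = ((p.1 - s : ℝ) : ℂ) * conj (dslope (q x) s p.1) := by
          rw [← map_sub, h3, map_mul, Complex.conj_ofReal]
        ext i j
        fin_cases i <;> fin_cases j
        · simp [zsMatrix, sigma3, potentialMatrix]; ring
        · simpa [zsMatrix, sigma3, potentialMatrix] using h3
        · simpa [zsMatrix, sigma3, potentialMatrix] using h4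
        · simp [zsMatrix, sigma3, potentialMatrix]; ring
      simp only [h2, mul_add, add_mul, mul_smul_comm, smul_mul_assoc]
    · exact Continuous.intervalIntegrable (((hWc.mul (continuous_const
        (y := -Complex.I • sigma3))).mul hpY).const_smul (p.2 - w)) _ _
    · exact Continuous.intervalIntegrable
        (((hWc.mul hpG).mul hpY).const_smul ((p.1 - s : ℝ) : ℂ)) _ _

end IsNLSSolution

end

/-- Carathéodory's form of differentiability, the form in which the expansion of the monodromy is
used. -/
theorem hasDerivAt_of_eventually_sub_eq_smul {𝕜 E : Type*} [NontriviallyNormedField 𝕜]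
    [NormedAddCommGroup E] [NormedSpace 𝕜 E] {f g : 𝕜 → E} {x : 𝕜}
    (h : ∀ᶠ y in 𝓝 x, f y - f x = (y - x) • g y) (hg : ContinuousAt g x) :
    HasDerivAt f (g x) x := by
  rw [hasDerivAt_iff_tendsto_slope]
  refine (hg.tendsto.mono_left nhdsWithin_le_nhds).congr' ?_
  filter_upwards [h.filter_mono nhdsWithin_le_nhds, self_mem_nhdsWithin] with y hy hne
  have hne' : y - x ≠ 0 := sub_ne_zero.2 hne
  rw [slope, vsub_eq_sub, hy, smul_smul, inv_mul_cancel₀ hne', one_smul]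

/-- A function all of whose zeros are strictly increasing has no two zeros. -/
theorem not_two_zeros_of_deriv_pos {f f' : ℝ → ℝ} {x y : ℝ} (hxy : x < y)
    (hf : ∀ t, HasDerivAt f (f' t) t) (hpos : ∀ t ∈ Set.Icc x y, f t = 0 → 0 < f' t)
    (hx : f x = 0) (hy : f y = 0) : False := by
  have hnn : ∀ t ∈ Set.Icc x y, 0 ≤ f t := by
    intro t ht
    refine image_le_of_deriv_right_lt_deriv_boundary (f := fun _ => (0 : ℝ)) (f' := fun _ => 0)
      (B := f) (B' := f') continuousOn_const (fun t _ => hasDerivWithinAt_const _ _ _) hx.ge hf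
      (fun t ht h => hpos t ⟨ht.1, ht.2.le⟩ h.symm) ht
  have h1 := hpos y ⟨hxy.le, le_rfl⟩ hy
  have h2 := (hf y).tendsto_slope
  -- To the left of y the function is nonnegative and at y it vanishes, so the left slopes cannot
  -- tend to a positive number.
  have h3 : ∀ᶠ z in 𝓝[<] y, slope f y z ≤ 0 := by
    filter_upwards [Ioo_mem_nhdsLT hxy] with z hz
    rw [slope_def_field, hy, sub_zero]
    exact div_nonpos_of_nonneg_of_nonpos (hnn z ⟨hz.1.le, hz.2.le⟩) (by linarith [hz.2])
  have h4 : Tendsto (slope f y) (𝓝[<] y) (𝓝 (f' y)) :=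
    h2.mono_left (nhdsWithin_mono _ fun z hz => ne_of_lt hz)
  exact absurd (le_of_tendsto h4 h3) (not_le.2 h1)

/-! ### The entry `ỹ₁₂`: Floquet multipliers, reality, and its zeros. -/

section

attribute [local instance] Matrix.linftyOpNormedRing Matrix.linftyOpNormedAlgebra

local notation "Mat" => Matrix (Fin 2) (Fin 2) ℂ

/-- The entry `(1, 2)` of `U M U⁻¹`, as a functional of `M`. -/
def tildeEntry12 : Mat →L[ℂ] ℂ :=
  LinearMap.toContinuousLinearMap
    { toFun := fun M => Complex.I / 2 * (M 0 0 + M 1 0 - M 0 1 - M 1 1)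
      map_add' := fun M N => by simp only [Matrix.add_apply]; ring
      map_smul' := fun c M => by
        simp only [Matrix.smul_apply, smul_eq_mul, RingHom.id_apply]; ring }

theorem tildeEntry12_apply (M : Mat) :
    tildeEntry12 M = Complex.I / 2 * (M 0 0 + M 1 0 - M 0 1 - M 1 1) := rfl

theorem tildeEntry12_eq_zero_iff {M : Mat} : tildeEntry12 M = 0 ↔ M 0 0 + M 1 0 = M 0 1 + M 1 1 := by
  rw [tildeEntry12_apply, mul_eq_zero_iff_left (by simp), sub_sub, sub_eq_zero]

theorem Umat_inv : Umat⁻¹ = !![1 / 2, Complex.I / 2; 1 / 2, -Complex.I / 2] := by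
  refine Matrix.inv_eq_right_inv ?_
  ext i j
  fin_cases i <;> fin_cases j <;> simp [Umat, Matrix.mul_apply, Fin.sum_univ_two]
  all_goals ring_nf
  all_goals simp

theorem Ytilde_zero_one (u : ℝ → ℂ) (L : ℝ) (z : ℂ) :
    Ytilde u L z 0 1 = tildeEntry12 (monodromy u L z) := by
  rw [Ytilde, Umat_inv, tildeEntry12_apply, monodromy]
  simp [Umat, Matrix.mul_apply, Matrix.vecMul, dotProduct, Fin.sum_univ_two]
  ring

theorem Ytilde_one_one (u : ℝ → ℂ) (L : ℝ) (z : ℂ) : Ytilde u L z 1 1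
    = 1 / 2 * (monodromy u L z 0 0 - monodromy u L z 1 0 - monodromy u L z 0 1
      + monodromy u L z 1 1) := by
  rw [Ytilde, Umat_inv, monodromy]
  simp [Umat, Matrix.mul_apply, Matrix.vecMul, dotProduct, Fin.sum_univ_two]
  ring_nf
  simp
  ring

section floquet

variable {u : ℝ → ℂ} {L : ℝ} {z : ℂ}

theorem Ytilde_one_one_of_eq_zero (h : tildeEntry12 (monodromy u L z) = 0) :
    Ytilde u L z 1 1 = monodromy u L z 0 0 - monodromy u L z 0 1 := by
  rw [tildeEntry12_eq_zero_iff] at h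
  rw [Ytilde_one_one]
  linear_combination -h / 2

/-- At a zero of `ỹ₁₂`, the diagonal entries of the transformed monodromy are inverse. -/
theorem mul_Ytilde_one_one (hu : Continuous u) (h : tildeEntry12 (monodromy u L z) = 0) :
    (monodromy u L z 0 0 + monodromy u L z 1 0) * Ytilde u L z 1 1 = 1 := by
  rw [Ytilde_one_one_of_eq_zero h]
  have h1 := det_principalSolution hu z L
  change (monodromy u L z).det = 1 at h1
  rw [Matrix.det_fin_two] at h1
  rw [tildeEntry12_eq_zero_iff] at h
  linear_combination h1 + monodromy u L z 0 0 * h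

/-- Similarity preserves the trace, and M₁₁ + M₂₁ is `ỹ₁₁` at a zero of `ỹ₁₂`. With
`mul_Ytilde_one_one` this makes `ỹ₁₁` and `ỹ₂₂` the two roots of ρ² - 2Δρ + 1. -/
theorem two_mul_discriminant (h : tildeEntry12 (monodromy u L z) = 0) :
    2 * discriminant u L z
      = monodromy u L z 0 0 + monodromy u L z 1 0 + Ytilde u L z 1 1 := by
  rw [Ytilde_one_one_of_eq_zero h, discriminant, Matrix.trace_fin_two]
  rw [tildeEntry12_eq_zero_iff] at h
  linear_combination -h

end floquet

section reality

variable {u : ℝ → ℂ} (hu : Continuous u) (r : ℝ)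
include hu

/-- For real `z`, the principal solution commutes with complex conjugation followed by the
exchange of the two components. -/
theorem principalSolution_conj (x : ℝ) :
    principalSolution u r x 1 1 = conj (principalSolution u r x 0 0) ∧
      principalSolution u r x 0 1 = conj (principalSolution u r x 1 0) := by
  have hY := isPrincipalSolution_principalSolution hu r
  have hZ : IsPrincipalSolution u r fun x =>
      !![conj (principalSolution u r x 1 1), conj (principalSolution u r x 1 0);
         conj (principalSolution u r x 0 1), conj (principalSolution u r x 0 0)] := by
    refine ⟨?_, fun y i j => ?_⟩
    · ext i j
      fin_cases i <;> fin_cases j <;> simp [hY.1]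
    · fin_cases i <;> fin_cases j
      · refine (hY.2 y 1 1).star.congr_deriv ?_
        simp [zsMatrix, sigma3, potentialMatrix, Matrix.mul_apply, Fin.sum_univ_two]
        ring
      · refine (hY.2 y 1 0).star.congr_deriv ?_
        simp [zsMatrix, sigma3, potentialMatrix, Matrix.mul_apply, Fin.sum_univ_two]
        ring
      · refine (hY.2 y 0 1).star.congr_deriv ?_
        simp [zsMatrix, sigma3, potentialMatrix, Matrix.mul_apply, Fin.sum_univ_two]
        ring
      · refine (hY.2 y 0 0).star.congr_deriv ?_
        simp [zsMatrix, sigma3, potentialMatrix, Matrix.mul_apply, Fin.sum_univ_two]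
        ring
  have h := congrFun ((existsUnique_principalSolution hu r).unique hY hZ) x
  constructor
  · simpa using congrFun (congrFun h 1) 1
  · simpa using congrFun (congrFun h 0) 1

theorem discriminant_eq_re (L : ℝ) :
    discriminant u L r = ((discriminant u L r).re : ℂ) := by
  have h := (principalSolution_conj hu r L).1
  have h1 : discriminant u L r = ((principalSolution u r L 0 0).re : ℂ) := by
    rw [discriminant, monodromy, Matrix.trace_fin_two, h, Complex.add_conj]
    push_cast; ring
  rw [h1, Complex.ofReal_re]

/-- By the conjugation symmetry the entry is (i/2)(m - m̄) with m = M₁₁ + M₂₁. On the real line its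
zeros are thus those of a real function, and at a zero m itself is real. -/
theorem tildeEntry12_monodromy_eq_re (L : ℝ) :
    tildeEntry12 (monodromy u L r) = ((tildeEntry12 (monodromy u L r)).re : ℂ) := by
  obtain ⟨h1, h2⟩ := principalSolution_conj hu r L
  have h3 : tildeEntry12 (monodromy u L r)
      = ((-(principalSolution u r L 0 0 + principalSolution u r L 1 0).im : ℝ) : ℂ) := by
    rw [tildeEntry12_apply, monodromy, h1, h2]
    have h4 := Complex.sub_conj (principalSolution u r L 0 0 + principalSolution u r L 1 0)
    rw [map_add, Complex.add_im] at h4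
    rw [Complex.add_im]
    push_cast at h4 ⊢
    linear_combination Complex.I / 2 * h4
      + (((principalSolution u r L 0 0).im : ℂ) + (principalSolution u r L 1 0).im) * Complex.I_sq
  rw [h3, Complex.ofReal_re]

theorem multiplier_eq_re {L : ℝ} (h : tildeEntry12 (monodromy u L r) = 0) :
    monodromy u L r 0 0 + monodromy u L r 1 0
      = ((monodromy u L r 0 0 + monodromy u L r 1 0).re : ℂ) := by
  obtain ⟨h1, h2⟩ := principalSolution_conj hu r L
  rw [tildeEntry12_eq_zero_iff] at h
  rw [eq_comm, ← Complex.conj_eq_iff_re, h, map_add]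
  unfold monodromy at h ⊢
  rw [h1, h2, Complex.conj_conj, Complex.conj_conj, add_comm, h, h1, h2, add_comm]

/-- `∂ỹ₁₂/∂z` at a real zero of `ỹ₁₂` is `ỹ₁₁` times the squared norm of the first component of
the eigenfunction. -/
theorem tildeEntry12_variation {L : ℝ} (h : tildeEntry12 (monodromy u L r) = 0) :
    tildeEntry12 (monodromy u L r * ∫ x in (0 : ℝ)..L,
        inverseSolution u r x * (-Complex.I • sigma3) * principalSolution u r x)
      = (monodromy u L r 0 0 + monodromy u L r 1 0) * ((∫ x in (0 : ℝ)..L,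
        ‖principalSolution u r x 0 0 - principalSolution u r x 0 1‖ ^ 2 : ℝ) : ℂ) := by
  have hYc := principalSolution_continuous hu r
  have hWc := inverseSolution_continuous hu r
  -- The functional is N ↦ (i/2)(1, 1) N (1, -1)ᵀ, and its vanishing at M makes (1, 1) a left
  -- eigenvector of M.
  have hmul : ∀ N : Mat, tildeEntry12 (monodromy u L r * N)
      = (monodromy u L r 0 0 + monodromy u L r 1 0) * tildeEntry12 N := by
    intro N
    rw [tildeEntry12_eq_zero_iff] at h
    simp only [tildeEntry12_apply, Matrix.mul_apply, Fin.sum_univ_two]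
    linear_combination (-Complex.I / 2 * (N 1 0 - N 1 1)) * h
  have hcomm : tildeEntry12 (∫ x in (0 : ℝ)..L,
        inverseSolution u r x * (-Complex.I • sigma3) * principalSolution u r x)
      = ∫ x in (0 : ℝ)..L, tildeEntry12
        (inverseSolution u r x * (-Complex.I • sigma3) * principalSolution u r x) :=
    (ContinuousLinearMap.intervalIntegral_comp_comm (μ := volume) tildeEntry12 (Continuous.intervalIntegrable
      ((hWc.mul (continuous_const (y := -Complex.I • sigma3))).mul hYc) 0 L)).symm
  rw [hmul, ← intervalIntegral.integral_ofReal]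
  refine congrArg _ (hcomm.trans ?_)
  -- With φ the first component of Y (1, -1)ᵀ, symmetry gives Y (1, -1)ᵀ = (φ, -φ̄)ᵀ and (1, 1) Y⁻¹
  -- = (φ̄, φ), so the integrand is |φ|².
  · refine intervalIntegral.integral_congr fun x _ => ?_
    obtain ⟨h1, h2⟩ := principalSolution_conj hu r x
    have h3 := Complex.mul_conj' (principalSolution u r x 0 0 - principalSolution u r x 0 1)
    simp only [inverseSolution, Matrix.adjugate_fin_two, tildeEntry12_apply]
    push_cast
    rw [← h3, map_sub, h2, Complex.conj_conj]
    simp [sigma3, Matrix.mul_apply, Fin.sum_univ_two, h1, h2]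
    linear_combination (-(principalSolution u r x 0 0 - conj (principalSolution u r x 1 0))
      * (conj (principalSolution u r x 0 0) - principalSolution u r x 1 0)) * Complex.I_sq

theorem integral_normSq_pos {L : ℝ} (hL : 0 < L) : 0 < ∫ x in (0 : ℝ)..L,
    ‖principalSolution u r x 0 0 - principalSolution u r x 0 1‖ ^ 2 := by
  have hYc := principalSolution_continuous hu r
  have h : Continuous fun x =>
      ‖principalSolution u r x 0 0 - principalSolution u r x 0 1‖ ^ 2 :=
    ((hYc.matrix_elem 0 0).sub (hYc.matrix_elem 0 1)).norm.pow 2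
  refine intervalIntegral.integral_pos hL h.continuousOn (fun x _ => by positivity)
    ⟨0, ⟨le_rfl, hL.le⟩, ?_⟩
  rw [principalSolution_zero hu]
  simp

end reality

/-- Dirichlet eigenvalues are zeros of `ỹ₁₂(L, ·)`. -/
theorem tildeEntry12_eq_zero_of_mem_dirichletSpectrum {u : ℝ → ℂ} (hu : Continuous u) {L : ℝ}
    (hL : 0 < L) {z : ℂ} (hz : z ∈ dirichletSpectrum u L) :
    tildeEntry12 (monodromy u L z) = 0 := by
  obtain ⟨v, g, ⟨hg, hv⟩, hne, hode, hv0, hvL⟩ := hz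
  have hgi : ∀ j, IntegrableOn (fun x => g x j) (Set.Icc 0 L) := fun j =>
    (hg j).integrable (by norm_num)
  have hvc : ∀ j, ContinuousOn (fun x => v x j) (Set.Icc 0 L) := by
    intro j
    have h1 : ContinuousOn (fun x => v 0 j + ∫ s in (0 : ℝ)..x, g s j) (Set.Icc 0 L) := by
      refine continuousOn_const.add ?_
      have := intervalIntegral.continuousOn_primitive_interval (μ := volume)
        (f := fun s => g s j) (a := 0) (b := L) (by rw [Set.uIcc_of_le hL.le]; exact hgi j)
      rwa [Set.uIcc_of_le hL.le] at this
    exact h1.congr fun x hx => hv x hx j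
  -- Regularity: v is continuous on the period, so the equation gives its weak derivative a
  -- continuous representative w; extending v to the line makes w globally continuous and its
  -- primitive N differentiable everywhere.
  set V : Fin 2 → ℝ → ℂ := fun j => Set.IccExtend hL.le ((Set.Icc 0 L).domRestrict fun x => v x j)
    with hV
  have hVc : ∀ j, Continuous (V j) := fun j => (hvc j).domRestrict.Icc_extend'
  have hVv : ∀ j, ∀ x ∈ Set.Icc 0 L, V j x = v x j := fun j x hx => by
    simp [hV, Set.IccExtend_of_mem hL.le _ hx, Set.domRestrict_apply]
  set w : Fin 2 → ℝ → ℂ := ![fun x => -(Complex.I * z) * V 0 x + u x * V 1 x,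
    fun x => Complex.I * z * V 1 x + conj (u x) * V 0 x] with hw
  have hwc : ∀ j, Continuous (w j) := by
    intro j
    have h0 := hVc 0
    have h1 := hVc 1
    fin_cases j <;> simp [hw] <;> fun_prop
  have hgw : ∀ j, ∀ᵐ x ∂(volume.restrict (Set.Icc 0 L)), g x j = w j x := by
    intro j
    filter_upwards [hode, ae_restrict_mem measurableSet_Icc] with x hx hxI
    have e0 := congrFun hx 0
    have e1 := congrFun hx 1
    simp [Matrix.mulVec, dotProduct, Fin.sum_univ_two, sigma3, potentialMatrix] at e0 e1
    fin_cases j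
    · simp [hw, hVv _ x hxI]
      linear_combination -Complex.I * e0 + (g x 0 - u x * v x 1) * Complex.I_sq
    · simp [hw, hVv _ x hxI]
      linear_combination Complex.I * e1 + (g x 1 - conj (u x) * v x 0) * Complex.I_sq
  set N : Fin 2 → ℝ → ℂ := fun j x => v 0 j + ∫ s in (0 : ℝ)..x, w j s with hN
  have hNd : ∀ j x, HasDerivAt (N j) (w j x) x := fun j x =>
    (intervalIntegral.integral_hasDerivAt_right ((hwc j).intervalIntegrable 0 x)
      ((hwc j).stronglyMeasurableAtFilter _ _) (hwc j).continuousAt).const_add _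
  have hNv : ∀ j, ∀ x ∈ Set.Icc 0 L, N j x = v x j := by
    intro j x hx
    rw [hv x hx j, hN]
    simp only
    congr 1
    refine intervalIntegral.integral_congr_ae ?_
    have := (ae_restrict_iff' measurableSet_Icc).1 (hgw j)
    filter_upwards [this] with s hs hsx
    rw [Set.uIoc_of_le hx.1] at hsx
    exact (hs ⟨hsx.1.le, hsx.2.trans hx.2⟩).symm
  -- The vector solution is padded with a zero column so that the matrix calculus applies; Y⁻¹ X is
  -- then constant.
  set X : ℝ → Mat := fun x => !![N 0 x, 0; N 1 x, 0] with hX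
  have hXd : ∀ x ∈ Set.Icc 0 L, HasDerivAt X (zsMatrix u z x * X x) x := by
    intro x hx
    have e0 : w 0 x = (zsMatrix u z x * X x) 0 0 := by
      simp [hw, hX, zsMatrix, sigma3, potentialMatrix, hVv _ x hx, hNv _ x hx]
    have e1 : w 1 x = (zsMatrix u z x * X x) 1 0 := by
      simp [hw, hX, zsMatrix, sigma3, potentialMatrix, hVv _ x hx, hNv _ x hx]
      ring
    refine hasDerivAt_matrix fun i j => ?_
    fin_cases i <;> fin_cases j
    · exact (hNd 0 x).congr_deriv e0
    · exact (hasDerivAt_const x (0 : ℂ)).congr_deriv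
        (by simp [hX, Matrix.mul_apply, Fin.sum_univ_two])
    · exact (hNd 1 x).congr_deriv e1
    · exact (hasDerivAt_const x (0 : ℂ)).congr_deriv
        (by simp [hX, Matrix.mul_apply, Fin.sum_univ_two])
  have hWX : ∀ x ∈ Set.Icc 0 L, HasDerivAt (fun y => inverseSolution u z y * X y) 0 x := by
    intro x hx
    exact ((inverseSolution_hasDerivAt hu z x).mul (hXd x hx)).congr_deriv (by noncomm_ring)
  have hconst := constant_of_has_deriv_right_zero
    (fun x hx => (hWX x hx).continuousAt.continuousWithinAt)
    (fun x hx => (hWX x ⟨hx.1, hx.2.le⟩).hasDerivWithinAt)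
  have hXY : ∀ x ∈ Set.Icc 0 L, X x = principalSolution u z x * X 0 := by
    intro x hx
    have h1 := hconst x hx
    rw [inverseSolution_zero hu, one_mul] at h1
    rw [← h1, ← mul_assoc, mul_inverseSolution hu, one_mul]
  have h00 : (0 : ℝ) ∈ Set.Icc 0 L := ⟨le_rfl, hL.le⟩
  have hLL : L ∈ Set.Icc 0 L := ⟨hL.le, le_rfl⟩
  have hv1 : v 0 1 = -v 0 0 := by linear_combination hv0
  have hcomp : ∀ x ∈ Set.Icc 0 L, ∀ j : Fin 2,
      v x j = (principalSolution u z x j 0 - principalSolution u z x j 1) * v 0 0 := by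
    intro x hx j
    have h1 := congrFun (congrFun (hXY x hx) j) 0
    fin_cases j <;>
    · simp [hX, Matrix.mul_apply, Fin.sum_univ_two, hNv _ x hx, hNv _ 0 h00, hv1] at h1 ⊢
      rw [h1]; ring
  -- The condition at 0 makes v a multiple of Y (1, -1)ᵀ by v₁(0), which a nonzero v forces to be
  -- nonzero. The condition at L is then the vanishing of `ỹ₁₂`.
  have hc : v 0 0 ≠ 0 := by
    intro h0
    obtain ⟨x, hx, hvx⟩ := hne
    exact hvx (funext fun j => by rw [hcomp x hx j, h0, mul_zero]; rfl)
  rw [tildeEntry12_eq_zero_iff, monodromy]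
  rw [hcomp L hLL 0, hcomp L hLL 1, ← add_mul] at hvL
  have := (mul_eq_zero.1 hvL).resolve_right hc
  linear_combination this

end

/-! ### Uniqueness of the numbering -/

/-- Write f = g ∘ φ with φ strictly increasing on the integers. Then φ(j) - j is nondecreasing, and
the normalization at the origin gives φ(0) ≥ 0 and φ(-1) ≤ -1. -/
theorem le_and_le_of_strictMono_of_range_subset {f g : ℤ → ℝ} (hf : StrictMono f)
    (hg : StrictMono g) (hfg : Set.range f ⊆ Set.range g) (hf0 : f (-1) < 0 ∧ 0 ≤ f 0)
    (hg0 : g (-1) < 0 ∧ 0 ≤ g 0) (j : ℤ) : (0 ≤ j → g j ≤ f j) ∧ (j ≤ -1 → f j ≤ g j) := by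
  have h : ∀ j, ∃ k, g k = f j := fun j => hfg ⟨j, rfl⟩
  choose φ hφ using h
  have hφm : StrictMono φ := fun a b hab => by
    rw [← hg.lt_iff_lt, hφ, hφ]
    exact hf hab
  have hψ : Monotone fun j => φ j - j := monotone_int_of_le_succ fun j => by
    have := hφm (lt_add_one j)
    omega
  have h0 : -1 < φ 0 := by
    rw [← hg.lt_iff_lt, hφ]
    exact hg0.1.trans_le hf0.2
  have h1 : φ (-1) < 0 := by
    rw [← hg.lt_iff_lt, hφ]
    exact hf0.1.trans_le hg0.2
  refine ⟨fun hj => ?_, fun hj => ?_⟩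
  · rw [← hφ j, hg.le_iff_le]
    have := hψ hj
    simp only at this
    omega
  · rw [← hφ j, hg.le_iff_le]
    have := hψ hj
    simp only at this
    omega

theorem strictMono_int_eq_of_range_eq {f g : ℤ → ℝ} (hf : StrictMono f) (hg : StrictMono g)
    (hfg : Set.range f = Set.range g) (hf0 : f (-1) < 0 ∧ 0 ≤ f 0)
    (hg0 : g (-1) < 0 ∧ 0 ≤ g 0) (j : ℤ) : f j = g j := by
  have h1 := le_and_le_of_strictMono_of_range_subset hf hg hfg.subset hf0 hg0 j
  have h2 := le_and_le_of_strictMono_of_range_subset hg hf hfg.superset hg0 hf0 j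
  rcases le_or_gt 0 j with hj | hj
  · exact le_antisymm (h2.1 hj) (h1.1 hj)
  · exact le_antisymm (h1.2 (by omega)) (h2.2 (by omega))

namespace IsMainNumbering

variable {u v : ℝ → ℂ} {L : ℝ} {ζ ξ : ℤ → ℝ}

theorem lt_even_succ (h : IsMainNumbering u L ζ) (j : ℤ) : ζ (2 * j) < ζ (2 * (j + 1)) := by
  have h1 := h.gap_le (j + 1)
  rw [show 2 * (j + 1) - 1 = 2 * j + 1 by ring] at h1
  exact (h.band_lt j).trans_le h1

theorem strictMono_even (h : IsMainNumbering u L ζ) : StrictMono fun j => ζ (2 * j) :=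
  strictMono_int_of_lt_succ h.lt_even_succ

theorem monotone (h : IsMainNumbering u L ζ) : Monotone ζ := by
  refine monotone_int_of_le_succ fun k => ?_
  obtain ⟨j, rfl | rfl⟩ := k.even_or_odd'
  · exact (h.band_lt j).le
  · have h1 := h.gap_le (j + 1)
    rwa [show 2 * (j + 1) - 1 = 2 * j + 1 by ring,
      show 2 * (j + 1) = 2 * j + 1 + 1 by ring] at h1

/-- The points `ζ₂ⱼ` are the points of the main spectrum at which a band begins. -/
theorem range_even (h : IsMainNumbering u L ζ) : Set.range (fun j => ζ (2 * j))
    = {x : ℝ | (x : ℂ) ∈ mainSpectrum u L ∧ ∀ᶠ y : ℝ in 𝓝[>] x, ‖discriminant u L y‖ < 1} := by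
  have hband : ∀ j, ∀ᶠ y : ℝ in 𝓝[>] ζ (2 * j), ‖discriminant u L y‖ < 1 := fun j => by
    filter_upwards [Ioo_mem_nhdsGT (h.band_lt j)] with y hy using h.band j y hy
  ext x
  constructor
  · rintro ⟨j, rfl⟩
    exact ⟨(h.range _).1 ⟨_, rfl⟩, hband j⟩
  · rintro ⟨hx, hev⟩
    obtain ⟨k, rfl⟩ := (h.range x).2 hx
    obtain ⟨j, rfl | rfl⟩ := k.even_or_odd'
    · exact ⟨j, rfl⟩
    · refine ⟨j + 1, ?_⟩
      have h1 := h.gap_le (j + 1)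
      have h2 := h.gap (j + 1)
      rw [show 2 * (j + 1) - 1 = 2 * j + 1 by ring] at h1 h2
      -- An odd endpoint can begin a band only if its gap is degenerate, and then it is also an even
      -- endpoint.
      rcases h1.eq_or_lt with h3 | h3
      · exact h3.symm
      · have h4 : ∀ᶠ y : ℝ in 𝓝[>] ζ (2 * j + 1), 1 < ‖discriminant u L y‖ := by
          filter_upwards [Ioo_mem_nhdsGT h3] with y hy using h2 y hy
        obtain ⟨y, h5, h6⟩ := (h4.and hev).exists
        exact absurd h5 (not_lt.2 h6.le)

/-- The numbering of the main spectrum is determined by the discriminant. -/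
theorem unique (hΔ : discriminant u L = discriminant v L) (h : IsMainNumbering u L ζ)
    (h' : IsMainNumbering v L ξ) : ζ = ξ := by
  have hS : mainSpectrum u L = mainSpectrum v L := by rw [mainSpectrum, mainSpectrum, hΔ]
  have heven : ∀ j, ζ (2 * j) = ξ (2 * j) := by
    refine strictMono_int_eq_of_range_eq h.strictMono_even h'.strictMono_even ?_ h.origin h'.origin
    rw [h.range_even, h'.range_even, hS, hΔ]
  -- The point ζ₂ⱼ₊₁ is the first spectral point after ζ₂ⱼ; stated for general data so that it can
  -- be used both ways.
  have hodd : ∀ {u v : ℝ → ℂ} {ζ ξ : ℤ → ℝ}, IsMainNumbering u L ζ → IsMainNumbering v L ξ →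
      mainSpectrum u L = mainSpectrum v L → (∀ j, ζ (2 * j) = ξ (2 * j)) →
      ∀ j, ζ (2 * j + 1) ≤ ξ (2 * j + 1) := by
    intro u v ζ ξ h h' hS he j
    have h1 := (h'.range _).1 ⟨2 * j + 1, rfl⟩
    rw [← hS] at h1
    obtain ⟨k, hk⟩ := (h.range _).2 h1
    have h2 : ζ (2 * j) < ζ k := by rw [hk, he]; exact h'.band_lt j
    rw [← hk]
    exact h.monotone (h.monotone.reflect_lt h2)
  funext k
  obtain ⟨j, rfl | rfl⟩ := k.even_or_odd'
  · exact heven j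
  · exact le_antisymm (hodd h h' hS heven j) (hodd h' h hS.symm (fun j => (heven j).symm) j)

theorem one_le_norm_discriminant (h : IsMainNumbering u L ζ) (j : ℤ) {x : ℝ}
    (hx : x ∈ Set.Icc (ζ (2 * j - 1)) (ζ (2 * j))) : 1 ≤ ‖discriminant u L x‖ := by
  have hend : ∀ k, ‖discriminant u L (ζ k)‖ = 1 := fun k => by
    have h1 : discriminant u L (ζ k) ^ 2 = 1 := (h.range _).1 ⟨k, rfl⟩
    have h2 := congrArg norm h1
    rw [norm_pow, norm_one] at h2
    exact (pow_eq_one_iff_of_nonneg (norm_nonneg _) two_ne_zero).1 h2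
  rcases hx.1.eq_or_lt with h1 | h1
  · rw [← h1, hend]
  · rcases hx.2.eq_or_lt with h2 | h2
    · rw [h2, hend]
    · exact (h.gap j x ⟨h1, h2⟩).le

end IsMainNumbering

/-! ### The Floquet multiplier at a Dirichlet eigenvalue -/

theorem rho_eq_of_norm_lt_one {u : ℝ → ℂ} {L : ℝ} {z r : ℂ} (hr : IsFloquetMultiplier u L z r)
    (hr1 : ‖r‖ < 1) : rho u L z = r := by
  have h : ∃ r, IsFloquetMultiplier u L z r ∧ ‖r‖ < 1 := ⟨r, hr, hr1⟩
  rw [rho, if_pos h, innerMultiplier, dif_pos h]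
  exact floquetMultiplier_unique h.choose_spec.1 hr h.choose_spec.2 hr1

section

attribute [local instance] Matrix.linftyOpNormedRing Matrix.linftyOpNormedAlgebra

local notation "Mat" => Matrix (Fin 2) (Fin 2) ℂ

theorem dirichletSign_eq_zero {u : ℝ → ℂ} {L : ℝ} {z : ℂ} (h : ‖Ytilde u L z 1 1‖ = 1) :
    dirichletSign u L z = 0 := by
  rw [dirichletSign, h, Real.log_one, Real.sign_zero, neg_zero]

/-- If Δ² = 1, the quadratic for the multipliers has a double root at Δ = ±1. -/
theorem norm_Ytilde_one_one_of_discriminant {u : ℝ → ℂ} (hu : Continuous u) {L : ℝ} {z : ℂ}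
    (h : tildeEntry12 (monodromy u L z) = 0) (hΔ : discriminant u L z ^ 2 = 1) :
    ‖Ytilde u L z 1 1‖ = 1 := by
  have h1 := mul_Ytilde_one_one hu h
  have h2 := two_mul_discriminant h
  set n := Ytilde u L z 1 1
  set m := monodromy u L z 0 0 + monodromy u L z 1 0
  have h3 : (n ^ 2 - 1) ^ 2 = 0 := by
    have h4 : n ^ 2 + 1 = 2 * discriminant u L z * n := by rw [h2]; linear_combination -h1
    have h5 : (n ^ 2 + 1) ^ 2 = 4 * n ^ 2 := by rw [h4]; linear_combination 4 * n ^ 2 * hΔ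
    linear_combination h5
  have h4 : n ^ 2 = 1 := sub_eq_zero.1 (pow_eq_zero_iff two_ne_zero |>.1 h3)
  have h5 := congrArg norm h4
  rw [norm_pow, norm_one] at h5
  exact (pow_eq_one_iff_of_nonneg (norm_nonneg _) two_ne_zero).1 h5

/-- The multipliers n = `ỹ₂₂` and m = n⁻¹ are ρ and ρ⁻¹ in an order that the sign detects: n = ρ
when |n| < 1, m = ρ when |n| > 1. -/
theorem dirichletSign_mul_rho {u : ℝ → ℂ} (hu : Continuous u) {L r : ℝ}
    (h : tildeEntry12 (monodromy u L r) = 0) :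
    (dirichletSign u L r : ℂ) * (rho u L r - (rho u L r)⁻¹)
      = Ytilde u L r 1 1 - (monodromy u L r 0 0 + monodromy u L r 1 0) := by
  have h1 := mul_Ytilde_one_one hu h
  have h2 := two_mul_discriminant h
  have h3 := multiplier_eq_re hu r h
  set n := Ytilde u L r 1 1 with hn
  set m := monodromy u L r 0 0 + monodromy u L r 1 0
  have hnf : IsFloquetMultiplier u L r n := by
    rw [IsFloquetMultiplier, h2]; linear_combination -h1
  have hmf : IsFloquetMultiplier u L r m := by
    rw [IsFloquetMultiplier, h2]; linear_combination -h1
  have hm : m = n⁻¹ := eq_inv_of_mul_eq_one_left h1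
  have hn0 : n ≠ 0 := right_ne_zero_of_mul_eq_one h1
  have hnpos : 0 < ‖n‖ := norm_pos_iff.2 hn0
  rcases lt_trichotomy ‖n‖ 1 with hlt | heq | hgt
  · rw [rho_eq_of_norm_lt_one hnf hlt, dirichletSign, ← hn,
      Real.sign_of_neg (Real.log_neg hnpos hlt), hm]
    push_cast; ring
  -- Here the sign is zero, so the boundary value of ρ plays no role; m is real of modulus one,
  -- hence m = n = ±1 and the right side vanishes too.
  · rw [dirichletSign_eq_zero heq]
    have h4 : m ^ 2 = 1 := by
      have h5 : ‖m‖ = 1 := by rw [hm, norm_inv, heq, inv_one]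
      rw [h3, Complex.norm_real, Real.norm_eq_abs] at h5
      rw [h3, ← Complex.ofReal_pow, ← sq_abs, h5]
      simp
    push_cast
    linear_combination n * h4 - m * h1
  · have hmlt : ‖m‖ < 1 := by rw [hm, norm_inv]; exact inv_lt_one_of_one_lt₀ hgt
    rw [rho_eq_of_norm_lt_one hmf hmlt, dirichletSign, ← hn,
      Real.sign_of_pos (Real.log_pos hgt), hm, inv_inv]
    push_cast; ring

/-- At a zero of `ỹ₁₂`, (1, 1) is a left eigenvector of M for m = `ỹ₁₁` and (1, -1)ᵀ a right one for
n = `ỹ₂₂`. The functional therefore sends [B, M] to (n - m) times its value on B, which is -c₁. -/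
theorem tildeEntry12_commutator {u : ℝ → ℂ} {L : ℝ} {z : ℂ}
    (h : tildeEntry12 (monodromy u L z) = 0) :
    -tildeEntry12 (laxTimeMatrix u z 0 * monodromy u L z - monodromy u L z * laxTimeMatrix u z 0)
      = c1 u z * (Ytilde u L z 1 1 - (monodromy u L z 0 0 + monodromy u L z 1 0)) := by
  rw [Ytilde_one_one_of_eq_zero h]
  rw [tildeEntry12_eq_zero_iff] at h
  have h1 := Complex.mul_conj' (u 0)
  rw [c1, ← h1, tildeEntry12_apply]
  simp only [Matrix.sub_apply, Matrix.mul_apply, Fin.sum_univ_two, laxTimeMatrix, Matrix.of_apply,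
    Matrix.cons_val', Matrix.cons_val_zero, Matrix.cons_val_one, Matrix.cons_val_fin_one]
  have hI := Complex.I_sq
  linear_combination (-(Complex.I / 2) * (2 * z * u 0 + Complex.I * deriv u 0
    + 2 * z * conj (u 0) - Complex.I * conj (deriv u 0))) * h
    + (monodromy u L z 1 0 + monodromy u L z 0 1) * (-2 * z ^ 2 - u 0 * conj (u 0)
      - 1 / 2 * (deriv u 0 + conj (deriv u 0))) * hI

/-! ### Conservation of Δ and motion of the Dirichlet eigenvalues. -/

namespace IsNLSSolution

variable {L : ℝ} {J : Set ℝ} {q : ℝ → ℝ → ℂ} (hq : IsNLSSolution L J q)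
include hq

theorem monodromy_continuousAt (hL : 0 ≤ L) (hJ : IsOpen J) {s : ℝ} (hs : s ∈ J) (w : ℂ) :
    ContinuousAt (fun p : ℝ × ℂ => monodromy (fun y => q y p.1) L p.2) (s, w) := by
  obtain ⟨a, b, ha, hb, -, -, hab⟩ := hq.monodromy_expansion hL hJ hs w
  have h1 : ContinuousAt (fun p : ℝ × ℂ => monodromy (fun y => q y s) L w
      + ((p.2 - w) • a p + ((p.1 - s : ℝ) : ℂ) • b p)) (s, w) := by
    have h2 : Continuous fun p : ℝ × ℂ => p.2 - w := by fun_prop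
    have h3 : Continuous fun p : ℝ × ℂ => ((p.1 - s : ℝ) : ℂ) := by fun_prop
    exact continuousAt_const.add ((h2.continuousAt.smul ha).add (h3.continuousAt.smul hb))
  refine h1.congr ?_
  filter_upwards [hab] with p hp
  rw [← hp, add_sub_cancel]

/-- The discriminant is a conserved quantity. -/
theorem discriminant_eq (hL : 0 ≤ L) (hJ : IsOpen J) (hJc : J.OrdConnected) {s t : ℝ}
    (hs : s ∈ J) (ht : t ∈ J) :
    discriminant (fun y => q y s) L = discriminant (fun y => q y t) L := by
  funext w
  have hd : ∀ s ∈ J, HasDerivAt (fun t => discriminant (fun y => q y t) L w) 0 s := by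
    intro s hs
    obtain ⟨a, b, -, hb, -, hbs, hab⟩ := hq.monodromy_expansion hL hJ hs w
    have hc : ContinuousAt (fun t : ℝ => (t, w)) s := by fun_prop
    have hbt : ContinuousAt (fun t : ℝ => 1 / 2 * (b (t, w)).trace) s :=
      continuousAt_const.mul ((Continuous.matrix_trace continuous_id).continuousAt.tendsto.comp
        (hb.tendsto.comp hc.tendsto))
    have h0 : 1 / 2 * (b (s, w)).trace = 0 := by rw [hbs, trace_commutator, mul_zero]
    rw [← h0]
    refine hasDerivAt_of_eventually_sub_eq_smul ?_ hbt
    filter_upwards [hc.tendsto.eventually hab] with t ht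
    simp only [sub_self, zero_smul, zero_add] at ht
    rw [discriminant, discriminant, ← mul_sub, ← Matrix.trace_sub, ht, Matrix.trace_smul,
      Complex.real_smul, smul_eq_mul]
    ring
  exact hJ.is_const_of_deriv_eq_zero hJc.isPreconnected
    (fun s hs => (hd s hs).differentiableAt.differentiableWithinAt) (fun s hs => (hd s hs).deriv)
    hs ht

theorem tildeEntry12_hasDerivAt (hL : 0 ≤ L) (hJ : IsOpen J) {s : ℝ} (hs : s ∈ J) (w : ℂ) :
    HasDerivAt (fun z => tildeEntry12 (monodromy (fun y => q y s) L z))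
      (tildeEntry12 (monodromy (fun y => q y s) L w * ∫ x in (0 : ℝ)..L,
        inverseSolution (fun y => q y s) w x * (-Complex.I • sigma3)
          * principalSolution (fun y => q y s) w x)) w := by
  obtain ⟨a, b, ha, -, has, -, hab⟩ := hq.monodromy_expansion hL hJ hs w
  have hc : ContinuousAt (fun z : ℂ => (s, z)) w := by fun_prop
  rw [← has]
  refine hasDerivAt_of_eventually_sub_eq_smul (g := fun z => tildeEntry12 (a (s, z))) ?_
    ((tildeEntry12.continuous.tendsto _).comp (ha.tendsto.comp hc.tendsto))
  filter_upwards [hc.tendsto.eventually hab] with z hz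
  simp only [sub_self, Complex.ofReal_zero, zero_smul, add_zero] at hz
  rw [← map_sub, hz, map_smul]

theorem Ytilde12Deriv_eq (hL : 0 < L) (hJ : IsOpen J) {s : ℝ} (hs : s ∈ J) (w : ℂ) :
    Ytilde12Deriv (fun y => q y s) L w
      = tildeEntry12 (monodromy (fun y => q y s) L w * ∫ x in (0 : ℝ)..L,
        inverseSolution (fun y => q y s) w x * (-Complex.I • sigma3)
          * principalSolution (fun y => q y s) w x) := by
  rw [Ytilde12Deriv]
  simp only [Ytilde_zero_one]
  exact (hq.tildeEntry12_hasDerivAt hL.le hJ hs w).deriv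

theorem Ytilde12Deriv_ne_zero (hL : 0 < L) (hJ : IsOpen J) {s : ℝ} (hs : s ∈ J) {r : ℝ}
    (h : tildeEntry12 (monodromy (fun y => q y s) L r) = 0) :
    Ytilde12Deriv (fun y => q y s) L r ≠ 0 := by
  have hqs := hq.continuous hs
  rw [hq.Ytilde12Deriv_eq hL hJ hs, tildeEntry12_variation hqs r h]
  exact mul_ne_zero (left_ne_zero_of_mul_eq_one (mul_Ytilde_one_one hqs h))
    (Complex.ofReal_ne_zero.2 (integral_normSq_pos hqs r hL).ne')

/-- On an interval where `|Δ| ≥ 1`, the function `ỹ₁₂(L, ·)` does not have two zeros. -/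
theorem not_two_dirichlet_zeros (hL : 0 < L) (hJ : IsOpen J) {s : ℝ} (hs : s ∈ J) {x y : ℝ}
    (hxy : x < y) (hΔ : ∀ t ∈ Set.Icc x y, 1 ≤ ‖discriminant (fun y => q y s) L (t : ℂ)‖)
    (hx : tildeEntry12 (monodromy (fun y => q y s) L x) = 0)
    (hy : tildeEntry12 (monodromy (fun y => q y s) L y) = 0) : False := by
  have hqs := hq.continuous hs
  set D : ℝ → ℝ := fun t => (discriminant (fun y => q y s) L t).re with hD
  have hDc : Continuous D := by
    refine continuous_iff_continuousAt.2 fun t => ?_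
    have h1 : ContinuousAt (fun t : ℝ => (s, (t : ℂ))) t := by fun_prop
    have h2 := (hq.monodromy_continuousAt hL.le hJ hs t).tendsto.comp h1.tendsto
    have h3 : Continuous fun M : Mat => (1 / 2 * M.trace).re :=
      Complex.continuous_re.comp
        (continuous_const.mul (Continuous.matrix_trace continuous_id))
    exact (h3.tendsto _).comp h2
  have hD0 : ∀ t ∈ Set.Icc x y, D t ≠ 0 := by
    intro t ht h0
    have h1 := hΔ t ht
    rw [discriminant_eq_re hqs, Complex.norm_real] at h1
    simp only [hD] at h0
    rw [h0, norm_zero] at h1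
    exact absurd h1 (by norm_num)
  have hDpos : ∀ t ∈ Set.Icc x y, 0 < D x * D t := by
    intro t ht
    by_contra hle
    have h1 : (0 : ℝ) ∈ (fun t => D x * D t) '' Set.Icc x t :=
      intermediate_value_Icc' ht.1 (continuousOn_const.mul hDc.continuousOn)
        ⟨not_lt.1 hle, mul_self_nonneg _⟩
    obtain ⟨c, hc, hc0⟩ := h1
    rcases mul_eq_zero.1 hc0 with h2 | h2
    · exact hD0 x ⟨le_rfl, hxy.le⟩ h2
    · exact hD0 c ⟨hc.1, hc.2.trans ht.2⟩ h2
  -- The discriminant keeps its sign on the interval, and m + 1/m = 2Δ gives m that sign at each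
  -- zero. The factor `D x` thus makes the derivative positive at every zero.
  refine not_two_zeros_of_deriv_pos (f := fun t => D x *
      (tildeEntry12 (monodromy (fun y => q y s) L t)).re) hxy
    (fun t => ((hq.tildeEntry12_hasDerivAt hL.le hJ hs t).real_of_complex).const_mul (D x))
    (fun t ht h0 => ?_) (by simp [hx]) (by simp [hy])
  have h1 : tildeEntry12 (monodromy (fun y => q y s) L t) = 0 := by
    rw [tildeEntry12_monodromy_eq_re hqs,
      (mul_eq_zero.1 h0).resolve_left (hD0 x ⟨le_rfl, hxy.le⟩), Complex.ofReal_zero]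
  rw [tildeEntry12_variation hqs t h1, Complex.re_mul_ofReal]
  have h2 := multiplier_eq_re hqs t h1
  have h3 := mul_Ytilde_one_one hqs h1
  have h4 := two_mul_discriminant h1
  rw [discriminant_eq_re hqs] at h4
  set m := monodromy (fun y => q y s) L t 0 0 + monodromy (fun y => q y s) L t 1 0
  have h5 : 2 * D t * m.re = m.re ^ 2 + 1 := by
    have : (2 * D t * m : ℂ) = m ^ 2 + 1 := by
      simp only [hD]
      rw [h4]; linear_combination h3
    rw [h2] at this
    exact_mod_cast this
  have h6 : 0 < D x * m.re := by
    have h7 : 0 < (D x * D t) * (D t * m.re) :=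
      mul_pos (hDpos t ht) (by nlinarith [sq_nonneg m.re])
    have h8 : (D x * D t) * (D t * m.re) = D t ^ 2 * (D x * m.re) := by ring
    rw [h8] at h7
    exact pos_of_mul_pos_right h7 (sq_nonneg _)
  rw [← mul_assoc]
  exact mul_pos h6 (integral_normSq_pos hqs t hL)

theorem dirichlet_zero_unique (hL : 0 < L) (hJ : IsOpen J) {s : ℝ} (hs : s ∈ J) {α β x y : ℝ}
    (hΔ : ∀ t ∈ Set.Icc α β, 1 ≤ ‖discriminant (fun y => q y s) L (t : ℂ)‖)
    (hxI : x ∈ Set.Icc α β) (hyI : y ∈ Set.Icc α β)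
    (hx : tildeEntry12 (monodromy (fun y => q y s) L x) = 0)
    (hy : tildeEntry12 (monodromy (fun y => q y s) L y) = 0) : x = y := by
  rcases lt_trichotomy x y with h | h | h
  · exact (hq.not_two_dirichlet_zeros hL hJ hs h
      (fun t ht => hΔ t ⟨hxI.1.trans ht.1, ht.2.trans hyI.2⟩) hx hy).elim
  · exact h
  · exact (hq.not_two_dirichlet_zeros hL hJ hs h
      (fun t ht => hΔ t ⟨hyI.1.trans ht.1, ht.2.trans hxI.2⟩) hy hx).elim

/-- The Dirichlet eigenvalue in a closed gap depends continuously on time. -/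
theorem dirichlet_continuousAt (hL : 0 < L) (hJ : IsOpen J) {s : ℝ} (hs : s ∈ J) {α β : ℝ}
    (hΔ : ∀ t ∈ Set.Icc α β, 1 ≤ ‖discriminant (fun y => q y s) L (t : ℂ)‖) {μ : ℝ → ℝ}
    (hμ : ∀ t ∈ J, μ t ∈ Set.Icc α β)
    (hμ0 : ∀ t ∈ J, tildeEntry12 (monodromy (fun y => q y t) L (μ t)) = 0) :
    ContinuousAt μ s := by
  -- Along any ultrafilter tending to s, compactness gives μ a limit in the gap. By joint continuity
  -- of M this limit is a zero at time s, and the zero is unique.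
  refine tendsto_iff_ultrafilter _ _ _ |>.2 fun U hU => ?_
  have hUJ : ∀ᶠ t in (U : Filter ℝ), t ∈ J := hU (hJ.mem_nhds hs)
  obtain ⟨m, hm, hUm⟩ := isCompact_Icc.ultrafilter_le_nhds (U.map μ)
    (le_principal_iff.2 (hUJ.mono fun t ht => hμ t ht) : ((U.map μ : Ultrafilter ℝ) : Filter ℝ)
      ≤ 𝓟 (Set.Icc α β))
  have hUm' : Tendsto μ U (𝓝 m) := hUm
  have h1 : Tendsto (fun t => (t, (μ t : ℂ))) U (𝓝 (s, (m : ℂ))) :=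
    Tendsto.prodMk_nhds hU ((Complex.continuous_ofReal.tendsto m).comp hUm')
  have h2 := (tildeEntry12.continuous.tendsto _).comp
    ((hq.monodromy_continuousAt hL.le hJ hs m).tendsto.comp h1)
  have h3 : tildeEntry12 (monodromy (fun y => q y s) L m) = 0 :=
    tendsto_nhds_unique h2 (tendsto_const_nhds.congr' (hUJ.mono fun t ht => (hμ0 t ht).symm))
  rw [hq.dirichlet_zero_unique hL hJ hs hΔ (hμ s hs) hm (hμ0 s hs) h3]
  exact hUm'

/-- Continuity of μ suffices: it makes the coefficients of the expansion along (t, μ(t)) continuous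
at s, and the one multiplying the increment of μ stays nonzero nearby. -/
theorem dirichlet_hasDerivAt (hL : 0 < L) (hJ : IsOpen J) {s : ℝ} (hs : s ∈ J) {μ : ℝ → ℝ}
    (hμc : ContinuousAt μ s)
    (hμ0 : ∀ t ∈ J, tildeEntry12 (monodromy (fun y => q y t) L (μ t)) = 0) :
    HasDerivAt (fun t => (μ t : ℂ))
      ((dirichletSign (fun x => q x s) L (μ s) : ℂ) * c1 (fun x => q x s) (μ s)
        * ((rho (fun x => q x s) L (μ s) - (rho (fun x => q x s) L (μ s))⁻¹)
          / Ytilde12Deriv (fun x => q x s) L (μ s))) s := by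
  obtain ⟨a, b, ha, hb, has, hbs, hab⟩ := hq.monodromy_expansion hL.le hJ hs (μ s)
  have hY := hq.Ytilde12Deriv_eq hL hJ hs (μ s)
  have hY0 := hq.Ytilde12Deriv_ne_zero hL hJ hs (hμ0 s hs)
  rw [← has] at hY
  have hc : Tendsto (fun t => (t, (μ t : ℂ))) (𝓝 s) (𝓝 (s, (μ s : ℂ))) :=
    Tendsto.prodMk_nhds tendsto_id ((Complex.continuous_ofReal.tendsto _).comp hμc.tendsto)
  have hat : ContinuousAt (fun t => tildeEntry12 (a (t, (μ t : ℂ)))) s :=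
    (tildeEntry12.continuous.tendsto _).comp (ha.tendsto.comp hc)
  have hbt : ContinuousAt (fun t => tildeEntry12 (b (t, (μ t : ℂ)))) s :=
    (tildeEntry12.continuous.tendsto _).comp (hb.tendsto.comp hc)
  have ha0 : tildeEntry12 (a (s, (μ s : ℂ))) ≠ 0 := hY ▸ hY0
  have hval : (dirichletSign (fun x => q x s) L (μ s) : ℂ) * c1 (fun x => q x s) (μ s)
        * ((rho (fun x => q x s) L (μ s) - (rho (fun x => q x s) L (μ s))⁻¹)
          / Ytilde12Deriv (fun x => q x s) L (μ s))
      = -tildeEntry12 (b (s, (μ s : ℂ))) / tildeEntry12 (a (s, (μ s : ℂ))) := by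
    rw [hbs, tildeEntry12_commutator (hμ0 s hs),
      ← dirichletSign_mul_rho (hq.continuous hs) (hμ0 s hs), hY]
    ring
  rw [hval]
  refine hasDerivAt_of_eventually_sub_eq_smul
    (g := fun t => -tildeEntry12 (b (t, (μ t : ℂ))) / tildeEntry12 (a (t, (μ t : ℂ)))) ?_
    (hbt.neg.div hat ha0)
  filter_upwards [hc.eventually hab, hat.eventually_ne ha0, hJ.mem_nhds hs] with t h1 h2 h3
  have h4 := congrArg tildeEntry12 h1
  rw [map_sub, hμ0 t h3, hμ0 s hs, map_add, map_smul, map_smul, sub_zero, smul_eq_mul,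
    smul_eq_mul] at h4
  rw [Complex.real_smul, ← mul_div_assoc, eq_div_iff h2]
  linear_combination -h4

end IsNLSSolution

end
end

end NLSDirichlet

/-! ### The evolution equation and the fixed eigenvalues. -/

theorem propositionp (L : ℝ) (hL : 0 < L)
    (J : Set ℝ) (hJo : IsOpen J) (hJc : J.OrdConnected)
    (q : ℝ → ℝ → ℂ) (hq : NLSDirichlet.IsNLSSolution L J q)
    (ζ : ℝ → ℤ → ℝ)
    (hζ : ∀ t ∈ J, NLSDirichlet.IsMainNumbering (fun x => q x t) L (ζ t))
    (μ : ℤ → ℝ → ℝ)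
    (hμ : ∀ t ∈ J,
      NLSDirichlet.IsDirichletNumbering (fun x => q x t) L (ζ t) (fun n => μ n t)) :
    -- the evolution equation
    (∀ n : ℤ, ∀ t ∈ J,
      NLSDirichlet.Ytilde12Deriv (fun x => q x t) L (μ n t) ≠ 0 ∧
      HasDerivAt (fun s => (μ n s : ℂ))
        ((NLSDirichlet.dirichletSign (fun x => q x t) L (μ n t) : ℂ)
          * NLSDirichlet.c1 (fun x => q x t) (μ n t)
          * ((NLSDirichlet.rho (fun x => q x t) L (μ n t)
              - (NLSDirichlet.rho (fun x => q x t) L (μ n t))⁻¹)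
            / NLSDirichlet.Ytilde12Deriv (fun x => q x t) L (μ n t))) t) ∧
    -- an eigenvalue with vanishing sign at all times does not move
    (∀ n : ℤ, (∀ t ∈ J, NLSDirichlet.dirichletSign (fun x => q x t) L (μ n t) = 0) →
      ∀ s ∈ J, ∀ t ∈ J, μ n t = μ n s) ∧
    -- a fixed eigenvalue (one in a degenerate gap) has vanishing sign and does not move
    (∀ n : ℤ, ∀ s ∈ J, ζ s (2 * n - 1) = ζ s (2 * n) →
      ∀ t ∈ J, NLSDirichlet.dirichletSign (fun x => q x t) L (μ n t) = 0 ∧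
        μ n t = μ n s) := by
  -- The gaps are constant in time, so each eigenvalue stays in one compact interval, as the
  -- continuity argument requires.
  have hζc : ∀ s ∈ J, ∀ t ∈ J, ζ s = ζ t := fun s hs t ht =>
    NLSDirichlet.IsMainNumbering.unique (hq.discriminant_eq hL.le hJo hJc hs ht) (hζ s hs) (hζ t ht)
  have hμ0 : ∀ n, ∀ t ∈ J, NLSDirichlet.tildeEntry12
      (NLSDirichlet.monodromy (fun y => q y t) L (μ n t)) = 0 := fun n t ht =>
    NLSDirichlet.tildeEntry12_eq_zero_of_mem_dirichletSpectrum (hq.continuous ht) hL (hμ t ht n).1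
  have hd : ∀ n : ℤ, ∀ t ∈ J, _ := fun n t ht =>
    hq.dirichlet_hasDerivAt hL hJo ht
      (hq.dirichlet_continuousAt hL hJo ht (fun x hx => (hζ t ht).one_le_norm_discriminant n hx)
        (fun s hs => hζc s hs t ht ▸ (hμ s hs n).2) (hμ0 n)) (hμ0 n)
  refine ⟨fun n t ht => ⟨hq.Ytilde12Deriv_ne_zero hL hJo ht (hμ0 n t ht), hd n t ht⟩,
    fun n hσ s hs t ht => ?_, fun n s hs hdeg t ht => ?_⟩
  · have h0 : ∀ r ∈ J, HasDerivAt (fun r => (μ n r : ℂ)) 0 r := fun r hr => by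
      simpa [hσ r hr] using hd n r hr
    exact_mod_cast hJo.is_const_of_deriv_eq_zero hJc.isPreconnected
      (fun r hr => (h0 r hr).differentiableAt.differentiableWithinAt)
      (fun r hr => (h0 r hr).deriv) ht hs
  -- A gap that is degenerate once is degenerate always and pins the eigenvalue to a point with Δ² =
  -- 1.
  · have hpos : ∀ r ∈ J, μ n r = ζ s (2 * n) := fun r hr => by
      have h1 := (hμ r hr n).2
      rw [← hζc s hs r hr, hdeg] at h1
      exact le_antisymm h1.2 h1.1
    refine ⟨NLSDirichlet.dirichletSign_eq_zero
      (NLSDirichlet.norm_Ytilde_one_one_of_discriminant (hq.continuous ht) (hμ0 n t ht) ?_),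
      (hpos t ht).trans (hpos s hs).symm⟩
    have h1 := ((hζ t ht).range (ζ t (2 * n))).1 ⟨_, rfl⟩
    rwa [← hζc s hs t ht, ← hpos t ht] at h1
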